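/- Let $\Bbbk$ be an algebraically closed field of characteristic zero, let $t,a,b,p,q,k\in\Bbbk$, and let $V$ be the $3$-dimensional vector space with basis $x_1,x_2,x_3$ and the braiding $c$ of type $\mathfrak R_{1,2}$ (writing $x_ix_j$ for $x_i\otimes x_j\in V\otimes V$): \begin{align*} c(x_1x_1)&=t\,x_1x_1, & c(x_2x_1)&=t\,x_1x_2, & c(x_3x_1)&=t(x_1x_3+b\,x_1x_1),\\ c(x_1x_2)&=t\,x_2x_1, & c(x_2x_2)&=t\,x_2x_2, & c(x_3x_2)&=t(x_2x_3+b\,x_2x_1+(p-q)\,x_1x_2),\\ c(x_1x_3)&=t(x_3x_1+p\,x_1x_1), & c(x_2x_3)&=t(x_3x_2+q\,x_1x_2), && \end{align*} $$c(x_3x_3)=t\,(x_3x_3+b\,x_3x_1-k\,x_2x_1+p\,x_1x_3+k\,x_1x_2+a\,x_1x_1).$$ Let $T(V)$ be the tensor algebra with its braided Hopf algebra structure in which the elements of $V$ are primitive, let $\mathcal J(V)$ be the largest homogeneous Hopf ideal of $T(V)$ generated by homogeneous elements of degree $\ge 2$, and let $\mathfrak B(V)=T(V)/\mathcal J(V)$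 be the Nichols algebra of $(V,c)$. (a) If $t=1$ and $b=p-2q$, then $$\mathcal J(V)=\langle x_2x_1-x_1x_2,\ x_3x_1-x_1x_3+q\,x_1^2,\ x_3x_2-x_2x_3+(2q-p)\,x_1x_2\rangle,$$ $B_3=\{x_1^{a_1}x_2^{a_2}x_3^{a_3}: a_i\ge 0\}$ is a basis of $\mathfrak B(V)$, and $\operatorname{GKdim}\mathfrak B(V)=3$. (b) If $t=-1$, $b=-p$ and $a\ne -p^2$, then $$\mathcal J(V)=\langle x_2x_1+x_1x_2,\ x_3x_1+x_1x_3,\ x_3x_2+x_2x_3+p\,x_1x_2,\ x_1^2,\ x_2^2\rangle,$$ $B_1=\{x_1^{a_1}x_2^{a_2}x_3^{a_3}: a_i\ge 0,\ a_1,a_2<2\}$ is a basis of $\mathfrak B(V)$, and $\operatorname{GKdim}\mathfrak B(V)=1$. (c) If $t=-1$, $b=-p$ and $a=-p^2$, then $$\mathcal J(V)=\langle x_2x_1+x_1x_2,\ x_3x_1+x_1x_3,\ x_3x_2+x_2x_3+p\,x_1x_2,\ x_1^2,\ x_2^2,\ x_3^2+k\,x_1x_2+p\,x_1x_3\rangle,$$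 $B_0=\{x_1^{a_1}x_2^{a_2}x_3^{a_3}: 0\le a_i<2\}$ is a basis of $\mathfrak B(V)$, $\operatorname{GKdim}\mathfrak B(V)=0$ and $\dim\mathfrak B(V)=8$. -/

import Mathlib

open scoped TensorProduct

noncomputable section

namespace Nichols

section General

/-! A finite-dimensional braided vector space `V` with basis `(x_i)_{i : ι}` is given by the
structure constants of its braiding, `c (x_i ⊗ x_j) = ∑ k l, r i j k l • x_k ⊗ x_l`.
Its tensor algebra `T(V)` is the free algebra on the `x_i`. -/

variable {𝕜 : Type*} [Field 𝕜] {ι : Type*} [Fintype ι] [DecidableEq ι]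

/-- The braiding `V ⊗ T(V) → T(V) ⊗ V` induced by `c`, in matrix form:
`c (x_i ⊗ y) = ∑ l, (braidMatrix r y) i l ⊗ x_l`. Compatibility with the multiplication,
`c (id ⊗ m) = (m ⊗ id) (id ⊗ c) (c ⊗ id)`, says that `braidMatrix r` is multiplicative. -/
def braidMatrix (r : ι → ι → ι → ι → 𝕜) :
    FreeAlgebra 𝕜 ι →ₐ[𝕜] Matrix ι ι (FreeAlgebra 𝕜 ι) :=
  FreeAlgebra.lift 𝕜 fun j => Matrix.of fun i l => ∑ k, r i j k l • FreeAlgebra.ι 𝕜 k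

/-- `braidLeft r i l` is the linear map `y ↦ (braidMatrix r y) i l`. -/
def braidLeft (r : ι → ι → ι → ι → 𝕜) (i l : ι) : FreeAlgebra 𝕜 ι →ₗ[𝕜] FreeAlgebra 𝕜 ι :=
  Matrix.entryLinearMap 𝕜 (FreeAlgebra 𝕜 ι) i l ∘ₗ (braidMatrix r).toLinearMap

/-- Left multiplication by `x_i ⊗ 1 + 1 ⊗ x_i` in the braided tensor product algebra
`T(V) ⊗ T(V)`, whose product is `(m ⊗ m) (id ⊗ c ⊗ id)`:
`y ⊗ z ↦ x_i y ⊗ z + ∑ l, (braidMatrix r y) i l ⊗ x_l z`. -/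
def comulStep (r : ι → ι → ι → ι → 𝕜) (i : ι) :
    Module.End 𝕜 (FreeAlgebra 𝕜 ι ⊗[𝕜] FreeAlgebra 𝕜 ι) :=
  TensorProduct.map (LinearMap.mulLeft 𝕜 (FreeAlgebra.ι 𝕜 i)) LinearMap.id +
    ∑ l, TensorProduct.map (braidLeft r i l) (LinearMap.mulLeft 𝕜 (FreeAlgebra.ι 𝕜 l))

/-- The comultiplication of the braided Hopf algebra `T(V)`: the algebra map to the braided
tensor product `T(V) ⊗ T(V)` for which every `x_i` is primitive. -/
def comul (r : ι → ι → ι → ι → 𝕜) (x : FreeAlgebra 𝕜 ι) :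
    FreeAlgebra 𝕜 ι ⊗[𝕜] FreeAlgebra 𝕜 ι :=
  FreeAlgebra.lift 𝕜 (comulStep r) x (1 ⊗ₜ[𝕜] 1)

/-- The map `y ↦ - m (c (x_i ⊗ y))`. -/
def antipodeStep (r : ι → ι → ι → ι → 𝕜) (i : ι) : Module.End 𝕜 (FreeAlgebra 𝕜 ι) :=
  -∑ l, LinearMap.mulRight 𝕜 (FreeAlgebra.ι 𝕜 l) ∘ₗ braidLeft r i l

/-- The antipode `S` of the braided Hopf algebra `T(V)`: it satisfies `S x_i = - x_i` and
`S ∘ m = m ∘ c ∘ (S ⊗ S)`, that is, `S 1 = 1` and `S (x_i y) = - m (c (x_i ⊗ S y))`. -/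
def antipode (r : ι → ι → ι → ι → 𝕜) (x : FreeAlgebra 𝕜 ι) : FreeAlgebra 𝕜 ι :=
  FreeAlgebra.lift 𝕜 (antipodeStep r) x 1

/-- The homogeneous component `T^n(V)`. -/
def degreePart (𝕜 : Type*) [Field 𝕜] (ι : Type*) (n : ℕ) : Submodule 𝕜 (FreeAlgebra 𝕜 ι) :=
  Submodule.span 𝕜 (Set.range (FreeAlgebra.ι 𝕜 (X := ι))) ^ n

/-- Homogeneous Hopf ideals of `T(V)` generated by homogeneous elements of degree at least `2`. -/
structure IsHomogeneousHopfIdeal (r : ι → ι → ι → ι → 𝕜)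
    (I : TwoSidedIdeal (FreeAlgebra 𝕜 ι)) : Prop where
  generated : ∃ s : Set (FreeAlgebra 𝕜 ι),
    (∀ x ∈ s, ∃ n, 2 ≤ n ∧ x ∈ degreePart 𝕜 ι n) ∧ I = TwoSidedIdeal.span s
  /-- `Δ(I) ⊆ I ⊗ T(V) + T(V) ⊗ I` -/
  comul_mem : ∀ x ∈ I, comul r x ∈
    Submodule.span 𝕜 {z | ∃ u v : FreeAlgebra 𝕜 ι, (u ∈ I ∨ v ∈ I) ∧ z = u ⊗ₜ[𝕜] v}
  counit_eq_zero : ∀ x ∈ I, FreeAlgebra.algebraMapInv x = 0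
  antipode_mem : ∀ x ∈ I, antipode r x ∈ I

/-- The ideal `J(V)` of relations of the Nichols algebra: the largest (i.e. the sum of all)
homogeneous Hopf ideal of `T(V)` generated by homogeneous elements of degree at least `2`. -/
def nicholsIdeal (r : ι → ι → ι → ι → 𝕜) : TwoSidedIdeal (FreeAlgebra 𝕜 ι) :=
  sSup {I | IsHomogeneousHopfIdeal r I}

/-- The Nichols algebra `B(V) = T(V) / J(V)`. -/
abbrev NicholsAlgebra (r : ι → ι → ι → ι → 𝕜) : Type _ :=
  (nicholsIdeal r).ringCon.Quotient

/-- The image of the basis vector `x_i` of `V` in `B(V)`. -/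
def gen (r : ι → ι → ι → ι → 𝕜) (i : ι) : NicholsAlgebra r :=
  (nicholsIdeal r).ringCon.mk' (FreeAlgebra.ι 𝕜 i)

end General

/-- The Gelfand-Kirillov dimension of an algebra: the supremum over the finite-dimensional
subspaces `W` of `limsup_n log (dim (W^0 + W^1 + ⋯ + W^n)) / log n`. -/
def gkDim (𝕜 A : Type*) [Field 𝕜] [Ring A] [Algebra 𝕜 A] : EReal :=
  ⨆ (W : Submodule 𝕜 A) (_ : W.FG),
    Filter.limsup (fun n : ℕ =>
      ((Real.log (Module.finrank 𝕜 (⨆ i ∈ Finset.range (n + 1), W ^ i : Submodule 𝕜 A)) /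
        Real.log n : ℝ) : EReal)) Filter.atTop

section RankThree

variable {𝕜 : Type*} [Field 𝕜]

/-- The `R`-matrix of type `(1, 2)`. Rows are indexed by the pairs `kl` in the order
`11, 12, 13, 21, 22, 23, 31, 32, 33`, columns by the pairs `ij` in the order
`11, 21, 31, 12, 22, 32, 13, 23, 33`. -/
def R12 (t a b p q k : 𝕜) : Matrix (Fin 9) (Fin 9) 𝕜 :=
  !![t, 0, t * b, 0, 0, 0,           t * p, 0,     t * a;
     0, t, 0,     0, 0, t * (p - q), 0,     t * q, t * k;
     0, 0, t,     0, 0, 0,           0,     0,     t * p;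
     0, 0, 0,     t, 0, t * b,       0,     0,     -(t * k);
     0, 0, 0,     0, t, 0,           0,     0,     0;
     0, 0, 0,     0, 0, t,           0,     0,     0;
     0, 0, 0,     0, 0, 0,           t,     0,     t * b;
     0, 0, 0,     0, 0, 0,           0,     t,     0;
     0, 0, 0,     0, 0, 0,           0,     0,     t]

/-- The structure constants of the braiding `c (x_i ⊗ x_j) = ∑ k l, r^{ij}_{kl} x_k ⊗ x_l`
associated with the `R`-matrix; `finProdFinEquiv (k, l) = 3 * k + l` for `k l : Fin 3`. The
basis vectors `x_1, x_2, x_3` have the indices `0, 1, 2`. -/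
def c12 (t a b p q k : 𝕜) (i j m l : Fin 3) : 𝕜 :=
  R12 t a b p q k (finProdFinEquiv (m, l)) (finProdFinEquiv (j, i))

/-- The generator `x_{i+1}` of the tensor algebra. -/
abbrev x (𝕜 : Type*) [Field 𝕜] (i : Fin 3) : FreeAlgebra 𝕜 (Fin 3) := FreeAlgebra.ι 𝕜 i

/-- Relations for `t = 1`, `b = p - 2q`. -/
def relA (p q : 𝕜) : Set (FreeAlgebra 𝕜 (Fin 3)) :=
  {x 𝕜 1 * x 𝕜 0 - x 𝕜 0 * x 𝕜 1,
   x 𝕜 2 * x 𝕜 0 - x 𝕜 0 * x 𝕜 2 + q • x 𝕜 0 ^ 2,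
   x 𝕜 2 * x 𝕜 1 - x 𝕜 1 * x 𝕜 2 + (2 * q - p) • (x 𝕜 0 * x 𝕜 1)}

/-- Relations for `t = -1`, `b = -p`, `a ≠ -p²`. -/
def relB (p : 𝕜) : Set (FreeAlgebra 𝕜 (Fin 3)) :=
  {x 𝕜 1 * x 𝕜 0 + x 𝕜 0 * x 𝕜 1,
   x 𝕜 2 * x 𝕜 0 + x 𝕜 0 * x 𝕜 2,
   x 𝕜 2 * x 𝕜 1 + x 𝕜 1 * x 𝕜 2 + p • (x 𝕜 0 * x 𝕜 1),
   x 𝕜 0 ^ 2,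
   x 𝕜 1 ^ 2}

/-- Relations for `t = -1`, `b = -p`, `a = -p²`. -/
def relC (p k : 𝕜) : Set (FreeAlgebra 𝕜 (Fin 3)) :=
  {x 𝕜 1 * x 𝕜 0 + x 𝕜 0 * x 𝕜 1,
   x 𝕜 2 * x 𝕜 0 + x 𝕜 0 * x 𝕜 2,
   x 𝕜 2 * x 𝕜 1 + x 𝕜 1 * x 𝕜 2 + p • (x 𝕜 0 * x 𝕜 1),
   x 𝕜 0 ^ 2,
   x 𝕜 1 ^ 2,
   x 𝕜 2 ^ 2 + k • (x 𝕜 0 * x 𝕜 1) + p • (x 𝕜 0 * x 𝕜 2)}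

/-- The monomials `x_1^{e_1} x_2^{e_2} x_3^{e_3}`, `e ∈ E`, form a basis of the Nichols algebra
(in particular, they are pairwise distinct). -/
def IsMonomialBasis (r : Fin 3 → Fin 3 → Fin 3 → Fin 3 → 𝕜) (E : Set (Fin 3 → ℕ)) : Prop :=
  LinearIndependent 𝕜 (fun e : E => gen r 0 ^ e.1 0 * gen r 1 ^ e.1 1 * gen r 2 ^ e.1 2) ∧
    Submodule.span 𝕜
      (Set.range fun e : E => gen r 0 ^ e.1 0 * gen r 1 ^ e.1 1 * gen r 2 ^ e.1 2) = ⊤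

/-- Exponents of the monomials in `B_0`. -/
def B0 : Set (Fin 3 → ℕ) := {e | ∀ i, e i < 2}

/-- Exponents of the monomials in `B_1`. -/
def B1 : Set (Fin 3 → ℕ) := {e | e 0 < 2 ∧ e 1 < 2}

/-- Exponents of the monomials in `B_3`. -/
def B3 : Set (Fin 3 → ℕ) := Set.univ

end RankThree

end Nichols

end

/-! Let `G` be the proposed set of relations, `I` the ideal it generates and `A` a quotient of T(V)
by `I`; generators are numbered x_0, x_1, x_2. Two inclusions give J(V) = `I`.

First, `I` is a Hopf ideal. Left multiplication by Δ(x_i) on T(V) ⊗ T(V) descends to an element of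
End(A) ⊗ A, and the antipode is governed in the same way by elements of End(A). So it suffices that
these elements again satisfy the relations in `G`. The braiding matrix of this V has only four
distinct nonzero entries S, T, B, C; their commutation rules with the x_i and with each other reduce
the check to a normal form computation (`isHomogeneousHopfIdeal_span`, `SatA.comulGen` and its
analogues).

Second, every admissible Hopf ideal is stable under the skew derivations ∂_k and killed by the
counit ε, hence by all functionals ε∂_0^l ∂_1^m ∂_2^n. If these are triangular on a spanning family
of `A`, they separate the points of `A`, so no such ideal exceeds `I`
(`nicholsIdeal_eq_of_triangular`). Triangularity also gives linear independence.

For t = 1 the family consists of the ordered monomials, the ∂_k act like partial derivatives, and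
the diagonal values are products of factorials. For t = -1 the key is s = x_2² + k x_0x_1 + p
x_0x_2, for which ∂_1 s = ∂_2 s = 0 and ∂_0 s = -(a+p²)x_0. If a = -p², then s is a further
relation. Otherwise ∂_0 runs down the chain 1, x_0, s, s x_0, s², … with nonzero scalars in
characteristic zero. The family is then s^m x_0^i x_1^j x_2^l with i, j, l < 2, and a dimension
count by degree transfers independence to the ordered monomials
(`mono_linearIndependent_of_family`).

The GK dimension follows by counting monomials of bounded degree. -/

noncomputable section

namespace Nichols

/-! ### Braiding, comultiplication and skew derivations on the tensor algebra. -/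

section Generalities

variable {𝕜 : Type*} [Field 𝕜] {ι : Type*}

/-- A subspace of the free algebra that contains `1` and is stable under left multiplication by
the generators is everything. -/
theorem mem_of_mulLeft_stable (S : Submodule 𝕜 (FreeAlgebra 𝕜 ι)) (one : 1 ∈ S)
    (mul : ∀ i, ∀ y ∈ S, FreeAlgebra.ι 𝕜 i * y ∈ S) (y : FreeAlgebra 𝕜 ι) : y ∈ S := by
  have key : ∀ x : FreeAlgebra 𝕜 ι, ∀ y ∈ S, x * y ∈ S := by
    intro x
    induction x using FreeAlgebra.induction with
    | grade0 c => intro y hy; rw [← Algebra.smul_def]; exact S.smul_mem _ hy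
    | grade1 i => exact mul i
    | mul a b ha hb => intro y hy; rw [mul_assoc]; exact ha _ (hb _ hy)
    | add a b ha hb => intro y hy; rw [add_mul]; exact S.add_mem (ha _ hy) (hb _ hy)
  simpa using key y 1 one

/-- Two linear maps out of the free algebra agree if they agree at `1` and agreement propagates
under left multiplication by the generators. -/
theorem linearMap_ext_of_mulLeft {M : Type*} [AddCommGroup M] [Module 𝕜 M]
    {f g : FreeAlgebra 𝕜 ι →ₗ[𝕜] M} (one : f 1 = g 1)
    (mul : ∀ i y, f y = g y → f (FreeAlgebra.ι 𝕜 i * y) = g (FreeAlgebra.ι 𝕜 i * y)) : f = g :=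
  LinearMap.ext fun y => mem_of_mulLeft_stable (LinearMap.eqLocus f g) one mul y

/-- A linear map that vanishes on the kernel of a surjection factors through it. -/
theorem exists_factor {M N P : Type*} [AddCommGroup M] [Module 𝕜 M] [AddCommGroup N] [Module 𝕜 N]
    [AddCommGroup P] [Module 𝕜 P] (f : M →ₗ[𝕜] N) (hf : Function.Surjective f) (g : M →ₗ[𝕜] P)
    (h : ∀ x, f x = 0 → g x = 0) : ∃ g' : N →ₗ[𝕜] P, ∀ x, g' (f x) = g x := by
  obtain ⟨s, hs⟩ := f.exists_rightInverse_of_surjective (LinearMap.range_eq_top.2 hf)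
  refine ⟨g ∘ₗ s, fun x => ?_⟩
  have : f (s (f x) - x) = 0 := by
    rw [map_sub, sub_eq_zero]; exact LinearMap.congr_fun hs (f x)
  exact sub_eq_zero.1 (by simpa using h _ this)

/-- A homomorphism kills the two-sided ideal generated by a set that it kills. -/
theorem map_eq_zero_of_mem_span {R S : Type*} [Ring R] [Ring S] (f : R →+* S) {G : Set R}
    (h : ∀ g ∈ G, f g = 0) {x : R} (hx : x ∈ TwoSidedIdeal.span G) : f x = 0 := by
  have : TwoSidedIdeal.span G ≤ TwoSidedIdeal.ker f :=
    TwoSidedIdeal.span_le.2 fun g hg => (TwoSidedIdeal.mem_ker f).2 (h g hg)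
  exact (TwoSidedIdeal.mem_ker f).1 (this hx)

theorem algebraMapInv_ι (i : ι) :
    FreeAlgebra.algebraMapInv (FreeAlgebra.ι 𝕜 i) = 0 := by simp [FreeAlgebra.algebraMapInv]

theorem algebraMapInv_eq_zero (n : ℕ) (y : FreeAlgebra 𝕜 ι) (hy : y ∈ degreePart 𝕜 ι (n + 1)) :
    FreeAlgebra.algebraMapInv y = 0 := by
  rw [degreePart, pow_succ'] at hy
  induction hy using Submodule.mul_induction_on' with
  | mem_mul_mem a ha b hb =>
    have : FreeAlgebra.algebraMapInv a = 0 := by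
      induction ha using Submodule.span_induction with
      | mem x hx => obtain ⟨i, rfl⟩ := hx; exact algebraMapInv_ι i
      | zero => simp
      | add x y _ _ hx hy => simp [hx, hy]
      | smul c x _ hx => simp [hx]
    simp [this]
  | add x _ y _ hx hy => simp [hx, hy]

theorem fst_lift (f : ι → 𝕜) (y : FreeAlgebra 𝕜 ι) :
    (FreeAlgebra.lift 𝕜 (A := DualNumber 𝕜) (fun i => f i • DualNumber.eps) y).fst =
      FreeAlgebra.algebraMapInv y := by
  have : (TrivSqZeroExt.fstHom 𝕜 𝕜 𝕜).comp
      (FreeAlgebra.lift 𝕜 (A := DualNumber 𝕜) (fun i => f i • DualNumber.eps)) =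
      FreeAlgebra.algebraMapInv := by
    ext i; simp [FreeAlgebra.algebraMapInv]
  exact AlgHom.congr_fun this y

variable [DecidableEq ι]

/-- The coefficient of the generator `x_k`. -/
def coeff (k : ι) : FreeAlgebra 𝕜 ι →ₗ[𝕜] 𝕜 :=
  TrivSqZeroExt.sndHom 𝕜 𝕜 ∘ₗ
    (FreeAlgebra.lift 𝕜 (A := DualNumber 𝕜)
      fun i => if i = k then DualNumber.eps else 0).toLinearMap

/-- The map to the dual numbers records the parts of degree zero and one in x_k simultaneously, so
multiplicativity becomes a Leibniz rule. -/
theorem coeff_mul (k : ι) (y z : FreeAlgebra 𝕜 ι) :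
    coeff k (y * z) =
      FreeAlgebra.algebraMapInv y * coeff k z + coeff k y * FreeAlgebra.algebraMapInv z := by
  have h := fst_lift (𝕜 := 𝕜) (fun i : ι => if i = k then 1 else 0)
  simp only [ite_smul, one_smul, zero_smul] at h
  simp [coeff, h, mul_comm]

theorem coeff_one (k : ι) : coeff k (1 : FreeAlgebra 𝕜 ι) = 0 := by simp [coeff]

theorem coeff_ι (k i : ι) : coeff k (FreeAlgebra.ι 𝕜 i) = if i = k then 1 else 0 := by
  simp only [coeff, LinearMap.comp_apply, AlgHom.toLinearMap_apply, FreeAlgebra.lift_ι_apply]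
  split_ifs <;> simp

variable [Fintype ι] (r : ι → ι → ι → ι → 𝕜)

theorem braidLeft_apply (i l : ι) (y : FreeAlgebra 𝕜 ι) :
    braidLeft r i l y = braidMatrix r y i l := rfl

theorem braidLeft_one (i l : ι) : braidLeft r i l 1 = if i = l then 1 else 0 := by
  simp [braidLeft_apply, Matrix.one_apply]

theorem braidLeft_mul (i l : ι) (y z : FreeAlgebra 𝕜 ι) :
    braidLeft r i l (y * z) = ∑ m, braidLeft r i m y * braidLeft r m l z := by
  simp [braidLeft_apply, Matrix.mul_apply]

theorem braidLeft_ι (i j l : ι) :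
    braidLeft r i l (FreeAlgebra.ι 𝕜 j) = ∑ k, r i j k l • FreeAlgebra.ι 𝕜 k := by
  simp [braidLeft_apply, braidMatrix]

/-- The comultiplication as a linear map. -/
def comulLinear : FreeAlgebra 𝕜 ι →ₗ[𝕜] FreeAlgebra 𝕜 ι ⊗[𝕜] FreeAlgebra 𝕜 ι :=
  LinearMap.applyₗ (1 ⊗ₜ[𝕜] 1) ∘ₗ (FreeAlgebra.lift 𝕜 (comulStep r)).toLinearMap

theorem comulLinear_apply (y : FreeAlgebra 𝕜 ι) : comulLinear r y = comul r y := rfl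

theorem comulLinear_one : comulLinear r 1 = 1 ⊗ₜ[𝕜] 1 := by
  simp [comulLinear]

theorem comulLinear_ι_mul (i : ι) (y : FreeAlgebra 𝕜 ι) :
    comulLinear r (FreeAlgebra.ι 𝕜 i * y) = comulStep r i (comulLinear r y) := by
  simp [comulLinear]

/-- The braiding preserves degree, so only the constant term of `y` contributes, and constants are
braided trivially. -/
theorem algebraMapInv_braidLeft (i l : ι) (y : FreeAlgebra 𝕜 ι) :
    FreeAlgebra.algebraMapInv (braidLeft r i l y) =
      if i = l then FreeAlgebra.algebraMapInv y else 0 := by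
  have : FreeAlgebra.algebraMapInv.toLinearMap ∘ₗ braidLeft r i l =
      (if i = l then 1 else 0 : 𝕜) • FreeAlgebra.algebraMapInv.toLinearMap := by
    refine linearMap_ext_of_mulLeft ?_ fun j y _ => ?_
    · by_cases h : i = l <;> simp [braidLeft_one, h]
    · by_cases h : i = l <;> simp [braidLeft_mul, braidLeft_ι, algebraMapInv_ι, h]
  have h := LinearMap.congr_fun this y
  by_cases hil : i = l <;> simpa [hil] using h

theorem coeff_braidLeft (k i l : ι) (y : FreeAlgebra 𝕜 ι) :
    coeff k (braidLeft r i l y) = ∑ j, r i j k l * coeff j y := by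
  have : coeff k ∘ₗ braidLeft r i l = ∑ j, r i j k l • coeff j := by
    refine linearMap_ext_of_mulLeft ?_ fun j y _ => ?_
    · simp [braidLeft_one, coeff_one, apply_ite (coeff k)]
    · simp [braidLeft_mul, braidLeft_ι, algebraMapInv_ι, coeff_mul, coeff_ι,
        algebraMapInv_braidLeft, LinearMap.sum_apply]
  simpa [LinearMap.sum_apply] using LinearMap.congr_fun this y

/-- Contraction of the first tensor factor with a functional. -/
def contract {M : Type*} [AddCommGroup M] [Module 𝕜 M] (f : M →ₗ[𝕜] 𝕜) (N : Type*)
    [AddCommGroup N] [Module 𝕜 N] : M ⊗[𝕜] N →ₗ[𝕜] N :=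
  TensorProduct.lid 𝕜 N ∘ₗ f.rTensor N

@[simp]
theorem contract_tmul {M : Type*} [AddCommGroup M] [Module 𝕜 M] (f : M →ₗ[𝕜] 𝕜) {N : Type*}
    [AddCommGroup N] [Module 𝕜 N] (m : M) (n : N) : contract f N (m ⊗ₜ n) = f m • n := by
  simp [contract]

/-- The skew derivations `∂_k` of `T(V)`: the component of `Δ y` in `V ⊗ T(V)` is
`∑ k, x_k ⊗ ∂_k y`. -/
def skewDer (k : ι) : FreeAlgebra 𝕜 ι →ₗ[𝕜] FreeAlgebra 𝕜 ι :=
  contract (coeff k) _ ∘ₗ comulLinear r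

/-- The left counit axiom. It supplies the term without derivative in the recursion for the skew
derivations. -/
theorem contract_counit_comul (y : FreeAlgebra 𝕜 ι) :
    contract FreeAlgebra.algebraMapInv.toLinearMap _ (comulLinear r y) = y := by
  have step : ∀ i, contract FreeAlgebra.algebraMapInv.toLinearMap _ ∘ₗ comulStep r i =
      LinearMap.mulLeft 𝕜 (FreeAlgebra.ι 𝕜 i) ∘ₗ
        contract FreeAlgebra.algebraMapInv.toLinearMap _ := by
    intro i
    ext u v
    simp [comulStep, LinearMap.sum_apply, algebraMapInv_ι, algebraMapInv_braidLeft]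
  have : contract FreeAlgebra.algebraMapInv.toLinearMap _ ∘ₗ comulLinear r = LinearMap.id := by
    refine linearMap_ext_of_mulLeft ?_ fun j y hy => ?_
    · simp [comulLinear_one]
    · have := LinearMap.congr_fun (step j) (comulLinear r y)
      simp only [LinearMap.comp_apply, LinearMap.id_apply] at this hy ⊢
      rw [comulLinear_ι_mul, this, hy, LinearMap.mulLeft_apply]
  exact LinearMap.congr_fun this y

theorem skewDer_one (k : ι) : skewDer r k 1 = 0 := by
  simp [skewDer, comulLinear_one, coeff_one]

/-- Comes from Δ(x_i y) = (x_i ⊗ 1 + 1 ⊗ x_i)Δ(y). The first summand meets V ⊗ T(V) only in x_i ⊗ y;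
the second carries x_i through the degree-one factor by the braiding. -/
theorem skewDer_ι_mul (k i : ι) (y : FreeAlgebra 𝕜 ι) :
    skewDer r k (FreeAlgebra.ι 𝕜 i * y) = (if i = k then y else 0) +
      ∑ j, ∑ l, r i j k l • (FreeAlgebra.ι 𝕜 l * skewDer r j y) := by
  have step : contract (coeff k) _ ∘ₗ comulStep r i =
      (if i = k then 1 else 0 : 𝕜) • contract FreeAlgebra.algebraMapInv.toLinearMap _ +
        ∑ j, ∑ l, r i j k l • (LinearMap.mulLeft 𝕜 (FreeAlgebra.ι 𝕜 l) ∘ₗ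
          contract (coeff j) _) := by
    ext u v
    simp only [comulStep, LinearMap.sum_apply, TensorProduct.AlgebraTensorModule.curry_apply,
      LinearMap.restrictScalars_self, TensorProduct.curry_apply, LinearMap.comp_apply,
      LinearMap.add_apply, TensorProduct.map_tmul, LinearMap.mulLeft_apply, LinearMap.id_apply,
      map_add, map_sum, contract_tmul, LinearMap.smul_apply, coeff_mul, algebraMapInv_ι, coeff_ι,
      coeff_braidLeft, zero_mul, zero_add, AlgHom.toLinearMap_apply, mul_smul_comm,
      Finset.sum_smul, smul_smul]
    rw [Finset.sum_comm]
  have := LinearMap.congr_fun step (comulLinear r y)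
  simp only [LinearMap.comp_apply, LinearMap.add_apply, LinearMap.smul_apply,
    LinearMap.sum_apply, LinearMap.mulLeft_apply, contract_counit_comul] at this
  simp only [skewDer, LinearMap.comp_apply, comulLinear_ι_mul, this]
  simp

-- The generators have degree at least two, so they and the whole ideal die in the dual numbers.
variable {r} in
theorem coeff_eq_zero_of_mem {I : TwoSidedIdeal (FreeAlgebra 𝕜 ι)}
    (hI : IsHomogeneousHopfIdeal r I) (k : ι) {x : FreeAlgebra 𝕜 ι} (hx : x ∈ I) :
    coeff k x = 0 := by
  obtain ⟨s, hs, rfl⟩ := hI.generated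
  have deg₂ : ∀ n, 2 ≤ n → ∀ y ∈ degreePart 𝕜 ι n, coeff k y = 0 := by
    intro n hn y hy
    obtain ⟨m, rfl⟩ : ∃ m, n = 1 + (m + 1) := ⟨n - 2, by omega⟩
    rw [degreePart, pow_add] at hy
    induction hy using Submodule.mul_induction_on' with
    | mem_mul_mem a ha b hb =>
      rw [coeff_mul, algebraMapInv_eq_zero 0 a ha, algebraMapInv_eq_zero m b hb]
      simp
    | add x _ y _ hx hy => simp [hx, hy]
  have := map_eq_zero_of_mem_span (FreeAlgebra.lift 𝕜 (A := DualNumber 𝕜)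
      fun i => if i = k then DualNumber.eps else 0).toRingHom (G := s) (fun g hg => by
    obtain ⟨n, hn, hgn⟩ := hs g hg
    have h1 := algebraMapInv_eq_zero (n - 1) g (by rwa [Nat.sub_add_cancel (by omega)])
    have h2 := deg₂ n hn g hgn
    have h := fst_lift (𝕜 := 𝕜) (fun i : ι => if i = k then 1 else 0) g
    simp only [ite_smul, one_smul, zero_smul] at h
    exact TrivSqZeroExt.ext (h.trans h1) h2) hx
  exact congrArg TrivSqZeroExt.snd this

variable {r} in
/-- Homogeneous Hopf ideals are stable under the skew derivations. -/
theorem skewDer_mem {I : TwoSidedIdeal (FreeAlgebra 𝕜 ι)}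
    (hI : IsHomogeneousHopfIdeal r I) (k : ι) {x : FreeAlgebra 𝕜 ι} (hx : x ∈ I) :
    skewDer r k x ∈ I := by
  have h := hI.comul_mem x hx
  rw [← comulLinear_apply] at h
  have key : ∀ z ∈ Submodule.span 𝕜
      {z | ∃ u v : FreeAlgebra 𝕜 ι, (u ∈ I ∨ v ∈ I) ∧ z = u ⊗ₜ[𝕜] v},
      contract (coeff k) _ z ∈ I := by
    intro z hz
    induction hz using Submodule.span_induction with
    | mem z hz =>
      obtain ⟨u, v, h | h, rfl⟩ := hz
      · simp [coeff_eq_zero_of_mem hI k h, I.zero_mem]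
      · rw [contract_tmul, Algebra.smul_def]; exact I.mul_mem_left _ _ h
    | zero => simp [I.zero_mem]
    | add x y _ _ hx hy => rw [map_add]; exact I.add_mem hx hy
    | smul c x _ hx => rw [map_smul, Algebra.smul_def]; exact I.mul_mem_left _ _ hx
  exact key _ h

end Generalities

/-! ### Criteria for an ideal to be a Hopf ideal, and operators on the quotient. -/

section HopfIdeals

variable {𝕜 : Type*} [Field 𝕜] {ι : Type*} {A : Type*} [Ring A] [Algebra 𝕜 A]
  {π : FreeAlgebra 𝕜 ι →ₐ[𝕜] A}

/-- By right exactness of the tensor product, the kernel of π ⊗ π is ker π ⊗ T(V) + T(V) ⊗ ker π.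
The coideal condition thereby becomes a vanishing statement in A ⊗ A. -/
theorem mem_span_tmul_of_map_eq_zero (hπ : Function.Surjective π)
    {I : TwoSidedIdeal (FreeAlgebra 𝕜 ι)} (hker : ∀ x, π x = 0 ↔ x ∈ I)
    {z : FreeAlgebra 𝕜 ι ⊗[𝕜] FreeAlgebra 𝕜 ι}
    (hz : TensorProduct.map π.toLinearMap π.toLinearMap z = 0) :
    z ∈ Submodule.span 𝕜 {z | ∃ u v : FreeAlgebra 𝕜 ι, (u ∈ I ∨ v ∈ I) ∧ z = u ⊗ₜ[𝕜] v} := by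
  have ex : Function.Exact (LinearMap.ker π.toLinearMap).subtype π.toLinearMap :=
    LinearMap.exact_subtype_ker_map _
  have hz' : z ∈ LinearMap.ker (TensorProduct.map π.toLinearMap π.toLinearMap) := hz
  rw [TensorProduct.map_ker ex hπ ex hπ] at hz'
  refine (sup_le ?_ ?_ : _ ≤ Submodule.span 𝕜 _) hz'
  · rintro _ ⟨w, rfl⟩
    induction w using TensorProduct.induction_on with
    | zero => simp
    | tmul u v =>
      exact Submodule.subset_span ⟨u, v, Or.inr ((hker _).1 v.2), by simp⟩
    | add x y hx hy => rw [map_add]; exact Submodule.add_mem _ hx hy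
  · rintro _ ⟨w, rfl⟩
    induction w using TensorProduct.induction_on with
    | zero => simp
    | tmul u v =>
      exact Submodule.subset_span ⟨u, v, Or.inl ((hker _).1 u.2), by simp⟩
    | add x y hx hy => rw [map_add]; exact Submodule.add_mem _ hx hy

variable [Fintype ι] [DecidableEq ι] (r : ι → ι → ι → ι → 𝕜) {G : Set (FreeAlgebra 𝕜 ι)}

/-- If the ideal generated by `G` is stable under the braiding with `V`, the operators `braidLeft`
descend to the quotient. -/
theorem exists_braid_quotient (hπ : Function.Surjective π)
    (hker : ∀ x, π x = 0 ↔ x ∈ TwoSidedIdeal.span G)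
    (h : ∀ g ∈ G, ∀ i l, π (braidLeft r i l g) = 0) :
    ∃ B : ι → ι → Module.End 𝕜 A, ∀ i l y, B i l (π y) = π (braidLeft r i l y) := by
  have h0 : ∀ x, π x = 0 → ∀ i l, π (braidLeft r i l x) = 0 := by
    intro x hx i l
    -- The matrix form of the braiding is an algebra map, so vanishing on `G` propagates to the
    -- ideal.
    have := map_eq_zero_of_mem_span
      ((π.mapMatrix (m := ι)).comp (braidMatrix r)).toRingHom (G := G)
      (fun g hg => by ext i l; exact h g hg i l) ((hker x).1 hx)
    exact congrFun (congrFun this i) l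
  choose B hB using fun i l => exists_factor π.toLinearMap hπ (π.toLinearMap ∘ₗ braidLeft r i l)
    fun x hx => h0 x hx i l
  exact ⟨B, hB⟩

/-- A criterion for an ideal generated in degree two to be a Hopf ideal. -/
theorem isHomogeneousHopfIdeal_span (hπ : Function.Surjective π)
    (hker : ∀ x, π x = 0 ↔ x ∈ TwoSidedIdeal.span G) (hdeg : ∀ g ∈ G, g ∈ degreePart 𝕜 ι 2)
    (B : ι → ι → Module.End 𝕜 A) (hB : ∀ i l y, B i l (π y) = π (braidLeft r i l y))
    (hcomul : ∀ g ∈ G, FreeAlgebra.lift 𝕜 (A := Module.End 𝕜 A ⊗[𝕜] A)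
      (fun i => Algebra.lmul 𝕜 A (π (FreeAlgebra.ι 𝕜 i)) ⊗ₜ 1 +
        ∑ l, B i l ⊗ₜ π (FreeAlgebra.ι 𝕜 l)) g = 0)
    (hanti : ∀ g ∈ G, FreeAlgebra.lift 𝕜
      (fun i => -∑ l, LinearMap.mulRight 𝕜 (π (FreeAlgebra.ι 𝕜 l)) * B i l) g = 0) :
    IsHomogeneousHopfIdeal r (TwoSidedIdeal.span G) where
  generated := ⟨G, fun x hx => ⟨2, le_rfl, hdeg x hx⟩, rfl⟩
  comul_mem := by
    intro x hx
    apply mem_span_tmul_of_map_eq_zero hπ hker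
    -- `Λ` sends x_i to the operator of left multiplication by Δ(x_i) on the quotient, and `Ξ` lets
    -- End(A) ⊗ A act on A ⊗ A, the second factor by left multiplication. Then (π ⊗ π)Δ is the
    -- action of `Λ` on 1 ⊗ 1; being an algebra map, `Λ` vanishes on the ideal once it vanishes on
    -- `G`.
    let Λ : FreeAlgebra 𝕜 ι →ₐ[𝕜] Module.End 𝕜 A ⊗[𝕜] A := FreeAlgebra.lift 𝕜
      (fun i => Algebra.lmul 𝕜 A (π (FreeAlgebra.ι 𝕜 i)) ⊗ₜ 1 +
        ∑ l, B i l ⊗ₜ π (FreeAlgebra.ι 𝕜 l))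
    let Ξ : Module.End 𝕜 A ⊗[𝕜] A →ₐ[𝕜] Module.End 𝕜 (A ⊗[𝕜] A) :=
      (Module.endTensorEndAlgHom (R := 𝕜) (S := 𝕜) (A := 𝕜) (M := A) (N := A)).comp
        (Algebra.TensorProduct.map (AlgHom.id 𝕜 _) (Algebra.lmul 𝕜 A))
    have step : ∀ i z, TensorProduct.map π.toLinearMap π.toLinearMap (comulStep r i z) =
        Ξ (Λ (FreeAlgebra.ι 𝕜 i)) (TensorProduct.map π.toLinearMap π.toLinearMap z) := by
      intro i z
      induction z using TensorProduct.induction_on with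
      | zero => simp
      | tmul u v => simp [comulStep, Λ, Ξ, hB, Module.endTensorEndAlgHom_apply, LinearMap.sum_apply]
      | add x y hx hy => simp only [map_add, hx, hy]
    have key : TensorProduct.map π.toLinearMap π.toLinearMap ∘ₗ comulLinear r =
        LinearMap.applyₗ (1 ⊗ₜ[𝕜] 1) ∘ₗ (Ξ.comp Λ).toLinearMap := by
      refine linearMap_ext_of_mulLeft ?_ fun i y hy => ?_
      · simp [comulLinear_one]
      · simp only [LinearMap.comp_apply, AlgHom.toLinearMap_apply, AlgHom.comp_apply,
          LinearMap.applyₗ_apply_apply] at hy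
        simp [comulLinear_ι_mul, step, hy]
    have := LinearMap.congr_fun key x
    simp only [LinearMap.comp_apply, AlgHom.toLinearMap_apply, AlgHom.comp_apply,
      LinearMap.applyₗ_apply_apply] at this
    rw [← comulLinear_apply, this, show Λ x = 0 from
      map_eq_zero_of_mem_span (S := Module.End 𝕜 A ⊗[𝕜] A) Λ.toRingHom hcomul hx]
    simp
  counit_eq_zero := by
    intro x hx
    refine map_eq_zero_of_mem_span FreeAlgebra.algebraMapInv.toRingHom (fun g hg => ?_) hx
    exact algebraMapInv_eq_zero 1 g (hdeg g hg)
  antipode_mem := by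
    intro x hx
    rw [← hker]
    -- The antipode reverses products only up to the braiding: y ↦ -m(c(x_i ⊗ y)) depends on x_i
    -- through an algebra map to End(A), so again only `G` has to be checked.
    let Λ : FreeAlgebra 𝕜 ι →ₐ[𝕜] Module.End 𝕜 A := FreeAlgebra.lift 𝕜
      (fun i => -∑ l, LinearMap.mulRight 𝕜 (π (FreeAlgebra.ι 𝕜 l)) * B i l)
    have key : π.toLinearMap ∘ₗ LinearMap.applyₗ 1 ∘ₗ
        (FreeAlgebra.lift 𝕜 (antipodeStep r)).toLinearMap =
        LinearMap.applyₗ 1 ∘ₗ Λ.toLinearMap := by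
      refine linearMap_ext_of_mulLeft ?_ fun i y hy => ?_
      · simp
      · simp only [LinearMap.comp_apply, AlgHom.toLinearMap_apply,
          LinearMap.applyₗ_apply_apply] at hy
        simp [antipodeStep, LinearMap.sum_apply, Λ, ← hB, hy]
    have := LinearMap.congr_fun key x
    simp only [LinearMap.comp_apply, AlgHom.toLinearMap_apply,
      LinearMap.applyₗ_apply_apply] at this
    change π (FreeAlgebra.lift 𝕜 (antipodeStep r) x 1) = 0
    rw [this, show Λ x = 0 from map_eq_zero_of_mem_span Λ.toRingHom hanti hx]
    simp

/-- The skew derivations descend to the quotient by a Hopf ideal. -/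
theorem exists_skewDer_quotient (hπ : Function.Surjective π)
    (hker : ∀ x, π x = 0 ↔ x ∈ TwoSidedIdeal.span G)
    (hG : IsHomogeneousHopfIdeal r (TwoSidedIdeal.span G)) :
    ∃ D : ι → Module.End 𝕜 A, ∀ k y, D k (π y) = π (skewDer r k y) := by
  choose D hD using fun k => exists_factor π.toLinearMap hπ (π.toLinearMap ∘ₗ skewDer r k)
    fun x hx => (hker _).2 (skewDer_mem hG k ((hker _).1 hx))
  exact ⟨D, hD⟩

/-- The counit descends to the quotient by a Hopf ideal. -/
theorem exists_counit_quotient (hπ : Function.Surjective π)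
    (hker : ∀ x, π x = 0 ↔ x ∈ TwoSidedIdeal.span G)
    (hG : IsHomogeneousHopfIdeal r (TwoSidedIdeal.span G)) :
    ∃ ε : A →ₗ[𝕜] 𝕜, ∀ y, ε (π y) = FreeAlgebra.algebraMapInv y :=
  exists_factor π.toLinearMap hπ FreeAlgebra.algebraMapInv.toLinearMap
    fun x hx => hG.counit_eq_zero x ((hker _).1 hx)

end HopfIdeals

/-! ### Triangular systems of functionals. -/

section Triangular

variable {𝕜 A : Type*} [Field 𝕜] [AddCommGroup A] [Module 𝕜 A]

/-- A combination of vectors `v e` that is killed by functionals `φ e` which are triangular with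
respect to the `v e` is trivial. -/
theorem eq_zero_of_triangular {E K : Type*} [LinearOrder K] (key : E → K)
    (hkey : Function.Injective key) (v : E → A) (φ : E → A →ₗ[𝕜] 𝕜)
    (hlt : ∀ e e', key e' < key e → φ e (v e') = 0) (hne : ∀ e, φ e (v e) ≠ 0)
    (c : E →₀ 𝕜) (hc : ∀ e, φ e (Finsupp.linearCombination 𝕜 v c) = 0) : c = 0 := by
  by_contra hne0
  obtain ⟨e, he, hmax⟩ := c.support.exists_max_image key (Finsupp.support_nonempty_iff.2 hne0)
  -- The index `e` has the largest key in the support, so its functional sees only the term at `e`.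
  have := hc e
  rw [Finsupp.linearCombination_apply, Finsupp.sum, map_sum, Finset.sum_eq_single_of_mem e he]
    at this
  · rw [map_smul, smul_eq_mul, mul_eq_zero] at this
    exact this.elim (Finsupp.mem_support_iff.1 he) (hne e)
  · intro e' he' hee
    rw [map_smul, hlt e e' ((hmax e' he').lt_of_ne fun h => hee (hkey h)), smul_zero]

theorem linearIndependent_of_triangular {E K : Type*} [LinearOrder K] (key : E → K)
    (hkey : Function.Injective key) (v : E → A) (φ : E → A →ₗ[𝕜] 𝕜)
    (hlt : ∀ e e', key e' < key e → φ e (v e') = 0) (hne : ∀ e, φ e (v e) ≠ 0) :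
    LinearIndependent 𝕜 v :=
  linearIndependent_iff.2 fun c hc =>
    eq_zero_of_triangular key hkey v φ hlt hne c fun e => by rw [hc, map_zero]

theorem eq_zero_of_triangular_of_span {E K : Type*} [LinearOrder K] (key : E → K)
    (hkey : Function.Injective key) (v : E → A) (φ : E → A →ₗ[𝕜] 𝕜)
    (hlt : ∀ e e', key e' < key e → φ e (v e') = 0) (hne : ∀ e, φ e (v e) ≠ 0)
    (hspan : Submodule.span 𝕜 (Set.range v) = ⊤) {x : A} (hx : ∀ e, φ e x = 0) : x = 0 := by
  obtain ⟨c, rfl⟩ := (Finsupp.mem_span_range_iff_exists_finsupp (v := v) (x := x)).1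
    (hspan ▸ Submodule.mem_top)
  have := eq_zero_of_triangular key hkey v φ hlt hne c fun e => hx e
  simp [this]

/-- Iterates of a lowering operator. -/
theorem pow_apply_eq_zero_of_lowering {D : Module.End 𝕜 A} {z : ℕ → A} {c : ℕ → 𝕜}
    (h0 : D (z 0) = 0) (h : ∀ j, D (z (j + 1)) = c j • z j) {n j : ℕ} (hj : j < n) :
    (D ^ n) (z j) = 0 := by
  induction j generalizing n with
  | zero =>
    obtain ⟨n, rfl⟩ : ∃ m, n = m + 1 := ⟨n - 1, by omega⟩
    rw [pow_succ, Module.End.mul_apply, h0, map_zero]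
  | succ j ih =>
    obtain ⟨n, rfl⟩ : ∃ m, n = m + 1 := ⟨n - 1, by omega⟩
    rw [pow_succ, Module.End.mul_apply, h, map_smul, ih (by omega), smul_zero]

theorem pow_apply_of_lowering {D : Module.End 𝕜 A} {z : ℕ → A} {c : ℕ → 𝕜}
    (h : ∀ j, D (z (j + 1)) = c j • z j) (n : ℕ) :
    (D ^ n) (z n) = (∏ j ∈ Finset.range n, c j) • z 0 := by
  induction n with
  | zero => simp
  | succ n ih =>
    rw [pow_succ, Module.End.mul_apply, h, map_smul, ih, smul_smul, Finset.prod_range_succ,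
      mul_comm]

end Triangular

/-! ### Normal form computations for the comultiplication and the antipode. -/

section NormalForms

set_option linter.unusedSimpArgs false

variable {𝕜 E : Type*} [Field 𝕜] [Ring E] [Algebra 𝕜 E]

/-- Lets a rule for a two-letter word fire inside a right-associated product. -/
theorem mul_mul_of_eq {u v w : E} (h : u * v = w) (z : E) : u * (v * z) = w * z := by
  rw [← mul_assoc, h]

/-- Commutation rules between multiplication operators `X_i` and the entries of the braiding
matrix. For left multiplications `q' = p` and `U = T`, for right multiplications `q' = q` and
`U = S`. -/
structure BraidRel (t a b p q k q' : 𝕜) (X : Fin 3 → E) (S T B C U : E) : Prop where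
  S0 : S * X 0 = t • (X 0 * S)
  S1 : S * X 1 = t • (X 1 * S)
  S2 : S * X 2 = t • (X 2 * S) + (t * p) • (X 0 * S)
  T0 : T * X 0 = t • (X 0 * T)
  T1 : T * X 1 = t • (X 1 * T)
  T2 : T * X 2 = t • (X 2 * T) + (t * q) • (X 0 * T)
  B0 : B * X 0 = t • (X 0 * B) + (t * b) • (X 0 * S)
  B1 : B * X 1 = t • (X 1 * B) + (t * b) • (X 1 * S)
  B2 : B * X 2 = t • (X 2 * B) + (t * p) • (X 0 * B) + (t * b) • (X 2 * S) - (t * k) • (X 1 * S)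
    + (t * a) • (X 0 * S)
  C0 : C * X 0 = t • (X 0 * C)
  C1 : C * X 1 = t • (X 1 * C) + (t * (p - q)) • (X 0 * U)
  C2 : C * X 2 = t • (X 2 * C) + (t * q') • (X 0 * C) + (t * k) • (X 0 * U)

/-- Commutation rules between the entries of the braiding matrix. -/
structure BraidComm (k : 𝕜) (S T B C : E) : Prop where
  TS : T * S = S * T
  BS : B * S = S * B
  BT : B * T = T * B
  CS : C * S = S * C
  CT : C * T = T * C
  BC : B * C = C * B + k • (S * S) - k • (S * T)

/-- All `y_i` commute with the `X_i` and the entries of the braiding matrix. -/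
structure CommuteAll (X y : Fin 3 → E) (S T B C : E) : Prop where
  X : ∀ i j, y i * X j = X j * y i
  S : ∀ i, y i * S = S * y i
  T : ∀ i, y i * T = T * y i
  B : ∀ i, y i * B = B * y i
  C : ∀ i, y i * C = C * y i

/-- The defining relations, oriented as rewriting rules towards ordered words. They are stated in an
arbitrary algebra because they are checked for the generators, for multiplication operators, for
braiding matrices, and for the images under the comultiplication and the antipode. -/
structure SatA (p q : 𝕜) (X : Fin 3 → E) : Prop where
  h10 : X 1 * X 0 = X 0 * X 1
  h20 : X 2 * X 0 = X 0 * X 2 - q • (X 0 * X 0)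
  h21 : X 2 * X 1 = X 1 * X 2 + (p - 2 * q) • (X 0 * X 1)

structure SatB (p : 𝕜) (X : Fin 3 → E) : Prop where
  h10 : X 1 * X 0 = -(X 0 * X 1)
  h20 : X 2 * X 0 = -(X 0 * X 2)
  h21 : X 2 * X 1 = -(X 1 * X 2) - p • (X 0 * X 1)
  h00 : X 0 * X 0 = 0
  h11 : X 1 * X 1 = 0

structure SatC (p k : 𝕜) (X : Fin 3 → E) : Prop extends SatB p X where
  h22 : X 2 * X 2 = -(k • (X 0 * X 1)) - p • (X 0 * X 2)

/-- The images of the generators under the comultiplication of a quotient. -/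
def comulGen (X y : Fin 3 → E) (S T B C : E) : Fin 3 → E :=
  ![X 0 + S * y 0, X 1 + T * y 1, X 2 + (B * y 0 + C * y 1 + S * y 2)]

/-- The images of the generators under the antipode of a quotient. -/
def antipodeGen (X : Fin 3 → E) (S T B C : E) : Fin 3 → E :=
  ![-(X 0 * S), -(X 1 * T), -(X 0 * B + X 1 * C + X 2 * S)]

/-- The rules sort every word with the `X i` first, then `S`, `T`, `C`, `B`, then the `y i`. With t
= 1 and b = p - 2q the coefficients of the sorted words agree on both sides. -/
theorem SatA.comulGen {a p q k : 𝕜} {X y : Fin 3 → E} {S T B C : E}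
    (hb : BraidRel 1 a (p - 2 * q) p q k p X S T B C T) (hc : BraidComm k S T B C)
    (hy : CommuteAll X y S T B C) (hX : SatA p q X) (hy' : SatA p q y) :
    SatA p q (comulGen X y S T B C) := by
  constructor <;> simp only [
    Nichols.comulGen, Matrix.cons_val_zero, Matrix.cons_val_one, Matrix.cons_val, mul_add, add_mul,
    mul_assoc, mul_smul_comm, smul_mul_assoc, sub_mul, mul_sub, neg_mul, mul_neg, hb.S0, hb.S1,
    hb.S2, hb.T0, hb.T1, hb.T2, hb.B0, hb.B1, hb.B2, hb.C0, hb.C1, hb.C2, hc.TS, hc.BS, hc.BT,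
    hc.CS, hc.CT, hc.BC, hX.h10, hX.h20, hX.h21, hy'.h10, hy'.h20, hy'.h21, hy.X,
    mul_mul_of_eq hb.S0, mul_mul_of_eq hb.S1, mul_mul_of_eq hb.S2, mul_mul_of_eq hb.T0,
    mul_mul_of_eq hb.T1, mul_mul_of_eq hb.T2, mul_mul_of_eq hb.B0, mul_mul_of_eq hb.B1,
    mul_mul_of_eq hb.B2, mul_mul_of_eq hb.C0, mul_mul_of_eq hb.C1, mul_mul_of_eq hb.C2,
    mul_mul_of_eq hc.TS, mul_mul_of_eq hc.BS, mul_mul_of_eq hc.BT, mul_mul_of_eq hc.CS,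
    mul_mul_of_eq hc.CT, mul_mul_of_eq hc.BC, mul_mul_of_eq (hy.X _ _), mul_mul_of_eq (hy.S _),
    mul_mul_of_eq (hy.T _), mul_mul_of_eq (hy.B _), mul_mul_of_eq (hy.C _)] <;> module

theorem SatB.comulGen {a p q k : 𝕜} {X y : Fin 3 → E} {S T B C : E}
    (hb : BraidRel (-1) a (-p) p q k p X S T B C T) (hc : BraidComm k S T B C)
    (hy : CommuteAll X y S T B C) (hX : SatB p X) (hy' : SatB p y) :
    SatB p (comulGen X y S T B C) := by
  constructor <;> simp only [
    Nichols.comulGen, Matrix.cons_val_zero, Matrix.cons_val_one, Matrix.cons_val, mul_add, add_mul,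
    mul_assoc, mul_smul_comm, smul_mul_assoc, sub_mul, mul_sub, neg_mul, mul_neg, hb.S0, hb.S1,
    hb.S2, hb.T0, hb.T1, hb.T2, hb.B0, hb.B1, hb.B2, hb.C0, hb.C1, hb.C2, hc.TS, hc.BS, hc.BT,
    hc.CS, hc.CT, hc.BC, hX.h10, hX.h20, hX.h21, hX.h00, hX.h11, hy'.h10, hy'.h20, hy'.h21, hy'.h00,
    hy'.h11, hy.X, mul_zero, zero_mul, smul_zero, neg_zero, mul_mul_of_eq hb.S0,
    mul_mul_of_eq hb.S1, mul_mul_of_eq hb.S2, mul_mul_of_eq hb.T0, mul_mul_of_eq hb.T1,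
    mul_mul_of_eq hb.T2, mul_mul_of_eq hb.B0, mul_mul_of_eq hb.B1, mul_mul_of_eq hb.B2,
    mul_mul_of_eq hb.C0, mul_mul_of_eq hb.C1, mul_mul_of_eq hb.C2, mul_mul_of_eq hc.TS,
    mul_mul_of_eq hc.BS, mul_mul_of_eq hc.BT, mul_mul_of_eq hc.CS, mul_mul_of_eq hc.CT,
    mul_mul_of_eq hc.BC, mul_mul_of_eq (hy.X _ _), mul_mul_of_eq (hy.S _), mul_mul_of_eq (hy.T _),
    mul_mul_of_eq (hy.B _), mul_mul_of_eq (hy.C _)] <;> module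

/-- The other relations are preserved for every a; the one for x_2² is where a = -p² is needed. -/
theorem SatC.comulGen {p q k : 𝕜} {X y : Fin 3 → E} {S T B C : E}
    (hb : BraidRel (-1) (-p ^ 2) (-p) p q k p X S T B C T) (hc : BraidComm k S T B C)
    (hy : CommuteAll X y S T B C) (hX : SatC p k X) (hy' : SatC p k y) :
    SatC p k (comulGen X y S T B C) := by
  refine ⟨SatB.comulGen hb hc hy hX.toSatB hy'.toSatB, ?_⟩
  simp only [
    Nichols.comulGen, Matrix.cons_val_zero, Matrix.cons_val_one, Matrix.cons_val, mul_add, add_mul,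
    mul_assoc, mul_smul_comm, smul_mul_assoc, sub_mul, mul_sub, neg_mul, mul_neg, hb.S0, hb.S1,
    hb.S2, hb.T0, hb.T1, hb.T2, hb.B0, hb.B1, hb.B2, hb.C0, hb.C1, hb.C2, hc.TS, hc.BS, hc.BT,
    hc.CS, hc.CT, hc.BC, hX.h10, hX.h20, hX.h21, hX.h00, hX.h11, hy'.h10, hy'.h20, hy'.h21, hy'.h00,
    hy'.h11, hX.h22, hy'.h22, hy.X, mul_zero, zero_mul, smul_zero, neg_zero, mul_mul_of_eq hb.S0,
    mul_mul_of_eq hb.S1, mul_mul_of_eq hb.S2, mul_mul_of_eq hb.T0, mul_mul_of_eq hb.T1,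
    mul_mul_of_eq hb.T2, mul_mul_of_eq hb.B0, mul_mul_of_eq hb.B1, mul_mul_of_eq hb.B2,
    mul_mul_of_eq hb.C0, mul_mul_of_eq hb.C1, mul_mul_of_eq hb.C2, mul_mul_of_eq hc.TS,
    mul_mul_of_eq hc.BS, mul_mul_of_eq hc.BT, mul_mul_of_eq hc.CS, mul_mul_of_eq hc.CT,
    mul_mul_of_eq hc.BC, mul_mul_of_eq (hy.X _ _), mul_mul_of_eq (hy.S _), mul_mul_of_eq (hy.T _),
    mul_mul_of_eq (hy.B _), mul_mul_of_eq (hy.C _)]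
  module

/-- The `X i` stand for right multiplications, which compose in reverse order; this changes the
signs of p and q in their relations. -/
theorem SatA.antipodeGen {a p q k : 𝕜} {X : Fin 3 → E} {S T B C : E}
    (hb : BraidRel 1 a (p - 2 * q) p q k q X S T B C S) (hc : BraidComm k S T B C)
    (hX : SatA (-p) (-q) X) : SatA p q (antipodeGen X S T B C) := by
  constructor <;> simp only [
    Nichols.antipodeGen, Matrix.cons_val_zero, Matrix.cons_val_one, Matrix.cons_val, mul_add,
    add_mul, mul_assoc, mul_smul_comm, smul_mul_assoc, sub_mul, mul_sub, neg_mul, mul_neg, hb.S0,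
    hb.S1, hb.S2, hb.T0, hb.T1, hb.T2, hb.B0, hb.B1, hb.B2, hb.C0, hb.C1, hb.C2, hc.TS, hc.BS,
    hc.BT, hc.CS, hc.CT, hc.BC, hX.h10, hX.h20, hX.h21, mul_mul_of_eq hb.S0, mul_mul_of_eq hb.S1,
    mul_mul_of_eq hb.S2, mul_mul_of_eq hb.T0, mul_mul_of_eq hb.T1, mul_mul_of_eq hb.T2,
    mul_mul_of_eq hb.B0, mul_mul_of_eq hb.B1, mul_mul_of_eq hb.B2, mul_mul_of_eq hb.C0,
    mul_mul_of_eq hb.C1, mul_mul_of_eq hb.C2, mul_mul_of_eq hc.TS, mul_mul_of_eq hc.BS,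
    mul_mul_of_eq hc.BT, mul_mul_of_eq hc.CS, mul_mul_of_eq hc.CT, mul_mul_of_eq hc.BC,
    mul_mul_of_eq hX.h10, mul_mul_of_eq hX.h20, mul_mul_of_eq hX.h21] <;> module

theorem SatB.antipodeGen {a p q k : 𝕜} {X : Fin 3 → E} {S T B C : E}
    (hb : BraidRel (-1) a (-p) p q k q X S T B C S) (hc : BraidComm k S T B C)
    (hX : SatB (-p) X) : SatB p (antipodeGen X S T B C) := by
  constructor <;> simp only [
    Nichols.antipodeGen, Matrix.cons_val_zero, Matrix.cons_val_one, Matrix.cons_val, mul_add,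
    add_mul, mul_assoc, mul_smul_comm, smul_mul_assoc, sub_mul, mul_sub, neg_mul, mul_neg, hb.S0,
    hb.S1, hb.S2, hb.T0, hb.T1, hb.T2, hb.B0, hb.B1, hb.B2, hb.C0, hb.C1, hb.C2, hc.TS, hc.BS,
    hc.BT, hc.CS, hc.CT, hc.BC, hX.h10, hX.h20, hX.h21, hX.h00, hX.h11, mul_zero, zero_mul,
    smul_zero, neg_zero, mul_mul_of_eq hb.S0, mul_mul_of_eq hb.S1, mul_mul_of_eq hb.S2,
    mul_mul_of_eq hb.T0, mul_mul_of_eq hb.T1, mul_mul_of_eq hb.T2, mul_mul_of_eq hb.B0,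
    mul_mul_of_eq hb.B1, mul_mul_of_eq hb.B2, mul_mul_of_eq hb.C0, mul_mul_of_eq hb.C1,
    mul_mul_of_eq hb.C2, mul_mul_of_eq hc.TS, mul_mul_of_eq hc.BS, mul_mul_of_eq hc.BT,
    mul_mul_of_eq hc.CS, mul_mul_of_eq hc.CT, mul_mul_of_eq hc.BC, mul_mul_of_eq hX.h10,
    mul_mul_of_eq hX.h20, mul_mul_of_eq hX.h21, mul_mul_of_eq hX.h00, mul_mul_of_eq hX.h11] <;>
    module

theorem SatC.antipodeGen {p q k : 𝕜} {X : Fin 3 → E} {S T B C : E}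
    (hb : BraidRel (-1) (-p ^ 2) (-p) p q k q X S T B C S) (hc : BraidComm k S T B C)
    (hX : SatC (-p) (-k) X) : SatC p k (antipodeGen X S T B C) := by
  refine ⟨SatB.antipodeGen hb hc hX.toSatB, ?_⟩
  simp only [
    Nichols.antipodeGen, Matrix.cons_val_zero, Matrix.cons_val_one, Matrix.cons_val, mul_add,
    add_mul, mul_assoc, mul_smul_comm, smul_mul_assoc, sub_mul, mul_sub, neg_mul, mul_neg, hb.S0,
    hb.S1, hb.S2, hb.T0, hb.T1, hb.T2, hb.B0, hb.B1, hb.B2, hb.C0, hb.C1, hb.C2, hc.TS, hc.BS,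
    hc.BT, hc.CS, hc.CT, hc.BC, hX.h10, hX.h20, hX.h21, hX.h00, hX.h11, hX.h22, mul_zero, zero_mul,
    smul_zero, neg_zero, mul_mul_of_eq hb.S0, mul_mul_of_eq hb.S1, mul_mul_of_eq hb.S2,
    mul_mul_of_eq hb.T0, mul_mul_of_eq hb.T1, mul_mul_of_eq hb.T2, mul_mul_of_eq hb.B0,
    mul_mul_of_eq hb.B1, mul_mul_of_eq hb.B2, mul_mul_of_eq hb.C0, mul_mul_of_eq hb.C1,
    mul_mul_of_eq hb.C2, mul_mul_of_eq hc.TS, mul_mul_of_eq hc.BS, mul_mul_of_eq hc.BT,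
    mul_mul_of_eq hc.CS, mul_mul_of_eq hc.CT, mul_mul_of_eq hc.BC, mul_mul_of_eq hX.h10,
    mul_mul_of_eq hX.h20, mul_mul_of_eq hX.h21, mul_mul_of_eq hX.h00, mul_mul_of_eq hX.h11,
    mul_mul_of_eq hX.h22]
  module

end NormalForms

/-! ### The entries of the braiding matrix of type R_{1,2}. -/

section RankThreeBraiding

variable {𝕜 : Type*} [Field 𝕜] (t a b p q k : 𝕜)

theorem braidMatrix_ι_zero : braidMatrix (c12 t a b p q k) (FreeAlgebra.ι 𝕜 0) =
    !![t • x 𝕜 0, 0, 0; 0, t • x 𝕜 0, 0; (t * b) • x 𝕜 0, 0, t • x 𝕜 0] := by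
  ext i j
  fin_cases i <;> fin_cases j <;>
    simp [braidMatrix, Fin.sum_univ_three, c12, R12, finProdFinEquiv]

theorem braidMatrix_ι_one : braidMatrix (c12 t a b p q k) (FreeAlgebra.ι 𝕜 1) =
    !![t • x 𝕜 1, 0, 0; 0, t • x 𝕜 1, 0;
      (t * b) • x 𝕜 1, (t * (p - q)) • x 𝕜 0, t • x 𝕜 1] := by
  ext i j
  fin_cases i <;> fin_cases j <;>
    simp [braidMatrix, Fin.sum_univ_three, c12, R12, finProdFinEquiv]

theorem braidMatrix_ι_two : braidMatrix (c12 t a b p q k) (FreeAlgebra.ι 𝕜 2) =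
    !![t • x 𝕜 2 + (t * p) • x 𝕜 0, 0, 0; 0, t • x 𝕜 2 + (t * q) • x 𝕜 0, 0;
      (t * b) • x 𝕜 2 - (t * k) • x 𝕜 1 + (t * a) • x 𝕜 0, (t * k) • x 𝕜 0,
        t • x 𝕜 2 + (t * p) • x 𝕜 0] := by
  ext i j
  fin_cases i <;> fin_cases j <;>
    simp [braidMatrix, Fin.sum_univ_three, c12, R12, finProdFinEquiv] <;> module

/-- The rows of the braiding matrix are supported as those of the generators. -/
theorem braidLeft_c12_eq_zero {i l : Fin 3} (hi : i ≠ 2) (hl : l ≠ i) :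
    braidLeft (c12 t a b p q k) i l = 0 := by
  refine linearMap_ext_of_mulLeft ?_ fun j y hy => ?_
  · simp [braidLeft_one, hl.symm]
  · rw [braidLeft_mul, Finset.sum_eq_single i, hy]
    · simp
    · intro m _ hm
      rw [braidLeft_apply]
      fin_cases j <;> fin_cases i <;> fin_cases m <;>
        simp_all [braidMatrix_ι_zero, braidMatrix_ι_one, braidMatrix_ι_two]
    · simp

/-- The entries (0,2) and (1,2) vanish, so the (2,2) entry is multiplicative, and it agrees with the
(0,0) entry on generators. -/
theorem braidLeft_c12_two_two :
    braidLeft (c12 t a b p q k) 2 2 = braidLeft (c12 t a b p q k) 0 0 := by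
  refine linearMap_ext_of_mulLeft (by simp [braidLeft_one]) fun j y hy => ?_
  simp only [braidLeft_mul, Fin.sum_univ_three, hy,
    braidLeft_c12_eq_zero t a b p q k (i := 0) (l := 1) (by decide) (by decide),
    braidLeft_c12_eq_zero t a b p q k (i := 0) (l := 2) (by decide) (by decide),
    braidLeft_c12_eq_zero t a b p q k (i := 1) (l := 2) (by decide) (by decide)]
  fin_cases j <;>
    simp [braidLeft_apply, braidMatrix_ι_zero, braidMatrix_ι_one, braidMatrix_ι_two]

/-- Multiplicativity and values on generators of the nonzero entries of the braiding matrix. -/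
structure BraidEntries (S T B C : Module.End 𝕜 (FreeAlgebra 𝕜 (Fin 3))) : Prop where
  S_one : S 1 = 1
  T_one : T 1 = 1
  B_one : B 1 = 0
  C_one : C 1 = 0
  S_mul : ∀ y z, S (y * z) = S y * S z
  T_mul : ∀ y z, T (y * z) = T y * T z
  B_mul : ∀ y z, B (y * z) = B y * S z + S y * B z
  C_mul : ∀ y z, C (y * z) = C y * T z + S y * C z
  S0 : S (x 𝕜 0) = t • x 𝕜 0
  S1 : S (x 𝕜 1) = t • x 𝕜 1
  S2 : S (x 𝕜 2) = t • x 𝕜 2 + (t * p) • x 𝕜 0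
  T0 : T (x 𝕜 0) = t • x 𝕜 0
  T1 : T (x 𝕜 1) = t • x 𝕜 1
  T2 : T (x 𝕜 2) = t • x 𝕜 2 + (t * q) • x 𝕜 0
  B0 : B (x 𝕜 0) = (t * b) • x 𝕜 0
  B1 : B (x 𝕜 1) = (t * b) • x 𝕜 1
  B2 : B (x 𝕜 2) = (t * b) • x 𝕜 2 - (t * k) • x 𝕜 1 + (t * a) • x 𝕜 0
  C0 : C (x 𝕜 0) = 0
  C1 : C (x 𝕜 1) = (t * (p - q)) • x 𝕜 0
  C2 : C (x 𝕜 2) = (t * k) • x 𝕜 0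

theorem braidEntries_c12 : BraidEntries t a b p q k (braidLeft (c12 t a b p q k) 0 0)
    (braidLeft (c12 t a b p q k) 1 1) (braidLeft (c12 t a b p q k) 2 0)
    (braidLeft (c12 t a b p q k) 2 1) := by
  have h01 := braidLeft_c12_eq_zero t a b p q k (i := 0) (l := 1) (by decide) (by decide)
  have h02 := braidLeft_c12_eq_zero t a b p q k (i := 0) (l := 2) (by decide) (by decide)
  have h10 := braidLeft_c12_eq_zero t a b p q k (i := 1) (l := 0) (by decide) (by decide)
  have h12 := braidLeft_c12_eq_zero t a b p q k (i := 1) (l := 2) (by decide) (by decide)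
  have h22 := braidLeft_c12_two_two t a b p q k
  constructor
  iterate 4 simp [braidLeft_one]
  iterate 4
    intro y z
    simp [braidLeft_mul, Fin.sum_univ_three, h01, h02, h10, h12, h22]
  all_goals simp [braidLeft_apply, braidMatrix_ι_zero, braidMatrix_ι_one, braidMatrix_ι_two]

variable {t a b p q k}

/-- The entries of the braiding matrix satisfy the expected commutation rules. -/
theorem BraidEntries.comm {S T B C : Module.End 𝕜 (FreeAlgebra 𝕜 (Fin 3))}
    (h : BraidEntries t a b p q k S T B C) : BraidComm k S T B C := by
  have TS : T * S = S * T := by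
    refine linearMap_ext_of_mulLeft (by simp [h.S_one, h.T_one]) fun j y hy => ?_
    simp only [Module.End.mul_apply] at hy ⊢
    fin_cases j <;> simp [h.S_mul, h.T_mul, hy, h.S0, h.S1, h.S2, h.T0, h.T1, h.T2,
      add_mul] <;> module
  have BS : B * S = S * B := by
    refine linearMap_ext_of_mulLeft (by simp [h.S_one, h.B_one]) fun j y hy => ?_
    simp only [Module.End.mul_apply] at hy ⊢
    fin_cases j <;> simp [h.S_mul, h.B_mul, hy, h.S0, h.S1, h.S2, h.B0, h.B1, h.B2, add_mul,
      sub_mul, smul_sub] <;> module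
  have BT : B * T = T * B := by
    refine linearMap_ext_of_mulLeft (by simp [h.T_one, h.B_one]) fun j y hy => ?_
    have TS' := fun y => LinearMap.congr_fun TS y
    simp only [Module.End.mul_apply] at hy TS' ⊢
    fin_cases j <;> simp [h.T_mul, h.B_mul, hy, TS', h.S0, h.S1, h.S2, h.T0, h.T1, h.T2,
      h.B0, h.B1, h.B2, add_mul, sub_mul, smul_sub] <;> module
  have CS : C * S = S * C := by
    refine linearMap_ext_of_mulLeft (by simp [h.S_one, h.C_one]) fun j y hy => ?_
    have TS' := fun y => LinearMap.congr_fun TS y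
    simp only [Module.End.mul_apply] at hy TS' ⊢
    fin_cases j <;> simp [h.S_mul, h.C_mul, hy, TS', h.S0, h.S1, h.S2, h.C0, h.C1, h.C2, add_mul]
      <;> module
  have CT : C * T = T * C := by
    refine linearMap_ext_of_mulLeft (by simp [h.T_one, h.C_one]) fun j y hy => ?_
    simp only [Module.End.mul_apply] at hy ⊢
    fin_cases j <;> simp [h.T_mul, h.C_mul, hy, h.S0, h.S1, h.S2, h.T0, h.T1, h.T2,
      h.C0, h.C1, h.C2, add_mul] <;> module
  -- The terms with k are visible on x_2: there BC - CB equals t²k(p-q)x_0, while S² - ST equals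
  -- t²(p-q)x_0.
  refine ⟨TS, BS, BT, CS, CT, ?_⟩
  refine linearMap_ext_of_mulLeft (by simp [h.S_one, h.T_one, h.B_one, h.C_one]) fun j y hy => ?_
  have CS' := fun y => LinearMap.congr_fun CS y
  have TS' := fun y => LinearMap.congr_fun TS y
  have BT' := fun y => LinearMap.congr_fun BT y
  simp only [Module.End.mul_apply, LinearMap.sub_apply, LinearMap.add_apply,
    LinearMap.smul_apply] at hy CS' TS' BT' ⊢
  fin_cases j <;> simp [h.S_mul, h.T_mul, h.B_mul, h.C_mul, hy, CS', TS', BT', h.S0, h.S1, h.S2,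
    h.T0, h.T1, h.T2, h.B0, h.B1, h.B2, h.C0, h.C1, h.C2, add_mul, sub_mul, mul_add, mul_sub,
    smul_sub] <;> module

end RankThreeBraiding

/-! ### Translation between generating sets and relations among operators. -/

section Relations

variable {𝕜 : Type*} [Field 𝕜] {E : Type*} [Ring E] [Algebra 𝕜 E] {p q k : 𝕜}

theorem forall_relA_iff (f : FreeAlgebra 𝕜 (Fin 3) →ₐ[𝕜] E) :
    (∀ g ∈ relA p q, f g = 0) ↔ SatA p q fun i => f (FreeAlgebra.ι 𝕜 i) := by
  constructor
  · intro h
    simp only [relA, Set.mem_insert_iff, Set.mem_singleton_iff, forall_eq_or_imp, forall_eq,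
      map_add, map_sub, map_mul, map_smul, pow_two] at h
    obtain ⟨h10, h20, h21⟩ := h
    refine ⟨sub_eq_zero.1 h10, ?_, ?_⟩
    · rw [← sub_eq_zero, ← h20]; abel
    · rw [← sub_eq_zero, ← h21]; module
  · rintro ⟨h10, h20, h21⟩
    simp only [relA, Set.mem_insert_iff, Set.mem_singleton_iff, forall_eq_or_imp, forall_eq,
      map_add, map_sub, map_mul, map_smul, pow_two, h10, h20, h21]
    refine ⟨?_, ?_, ?_⟩ <;> module

theorem forall_relB_iff (f : FreeAlgebra 𝕜 (Fin 3) →ₐ[𝕜] E) :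
    (∀ g ∈ relB p, f g = 0) ↔ SatB p fun i => f (FreeAlgebra.ι 𝕜 i) := by
  constructor
  · intro h
    simp only [relB, Set.mem_insert_iff, Set.mem_singleton_iff, forall_eq_or_imp, forall_eq,
      map_add, map_mul, map_smul, pow_two] at h
    obtain ⟨h10, h20, h21, h00, h11⟩ := h
    refine ⟨eq_neg_of_add_eq_zero_left h10, eq_neg_of_add_eq_zero_left h20, ?_, h00, h11⟩
    rw [← sub_eq_zero, ← h21]; module
  · rintro ⟨h10, h20, h21, h00, h11⟩
    simp only [relB, Set.mem_insert_iff, Set.mem_singleton_iff, forall_eq_or_imp, forall_eq,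
      map_add, map_mul, map_smul, pow_two, h10, h20, h21, h00, h11]
    refine ⟨by abel, by abel, by module, trivial, trivial⟩

theorem relC_eq : relC p k = relB p ∪
    {x 𝕜 2 ^ 2 + k • (x 𝕜 0 * x 𝕜 1) + p • (x 𝕜 0 * x 𝕜 2)} := by
  ext g
  simp only [relC, relB, Set.mem_union, Set.mem_insert_iff, Set.mem_singleton_iff, or_assoc]

theorem forall_relC_iff (f : FreeAlgebra 𝕜 (Fin 3) →ₐ[𝕜] E) :
    (∀ g ∈ relC p k, f g = 0) ↔ SatC p k fun i => f (FreeAlgebra.ι 𝕜 i) := by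
  have key : (∀ g ∈ relC p k, f g = 0) ↔ (∀ g ∈ relB p, f g = 0) ∧
      f (x 𝕜 2 ^ 2 + k • (x 𝕜 0 * x 𝕜 1) + p • (x 𝕜 0 * x 𝕜 2)) = 0 := by
    rw [relC_eq]
    simp only [Set.mem_union, or_imp, forall_and, Set.mem_singleton_iff, forall_eq]
  rw [key, forall_relB_iff]
  simp only [map_add, map_mul, map_smul, pow_two]
  refine ⟨fun h => ⟨h.1, ?_⟩, fun h => ⟨h.1, ?_⟩⟩
  · rw [← sub_eq_zero, ← h.2]; module
  · have := h.2
    rw [this]; module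

theorem SatA.mulRight {X : Fin 3 → E} (h : SatA p q X) :
    SatA (-p) (-q) fun i => LinearMap.mulRight 𝕜 (X i) := by
  constructor <;> ext z <;>
    simp only [Module.End.mul_apply, LinearMap.mulRight_apply, LinearMap.sub_apply,
      LinearMap.add_apply, LinearMap.smul_apply, mul_assoc, h.h10, h.h20, h.h21, mul_add, mul_sub,
      mul_smul_comm] <;> module

theorem SatB.mulRight {X : Fin 3 → E} (h : SatB p X) :
    SatB (-p) fun i => LinearMap.mulRight 𝕜 (X i) := by
  constructor <;> ext z <;>
    simp only [Module.End.mul_apply, LinearMap.mulRight_apply, LinearMap.sub_apply,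
      LinearMap.neg_apply, LinearMap.smul_apply, mul_assoc, h.h10, h.h20, h.h21, h.h00, h.h11,
      mul_sub, mul_neg, mul_zero, mul_smul_comm, LinearMap.zero_apply] <;> module

theorem SatC.mulRight {X : Fin 3 → E} (h : SatC p k X) :
    SatC (-p) (-k) fun i => LinearMap.mulRight 𝕜 (X i) := by
  refine ⟨h.toSatB.mulRight, ?_⟩
  ext z
  simp only [Module.End.mul_apply, LinearMap.mulRight_apply, LinearMap.sub_apply,
    LinearMap.neg_apply, LinearMap.smul_apply, mul_assoc, h.h10, h.h20, h.h22, mul_sub,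
    mul_neg, mul_smul_comm]
  module

end Relations

/-! ### The three ideals are Hopf ideals. -/

section HopfIdealsRankThree

variable {𝕜 : Type*} [Field 𝕜] {t a b p q k : 𝕜} {A : Type*} [Ring A] [Algebra 𝕜 A]
  {π : FreeAlgebra 𝕜 (Fin 3) →ₐ[𝕜] A}

theorem ι_mul_ι_mem_degreePart (i j : Fin 3) : x 𝕜 i * x 𝕜 j ∈ degreePart 𝕜 (Fin 3) 2 := by
  rw [degreePart, pow_two]
  exact Submodule.mul_mem_mul (Submodule.subset_span ⟨i, rfl⟩) (Submodule.subset_span ⟨j, rfl⟩)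

theorem relA_subset_degreePart : ∀ g ∈ relA p q, g ∈ degreePart 𝕜 (Fin 3) 2 := by
  have h := ι_mul_ι_mem_degreePart (𝕜 := 𝕜)
  simp only [relA, Set.mem_insert_iff, Set.mem_singleton_iff, forall_eq_or_imp, forall_eq, pow_two]
  exact ⟨sub_mem (h _ _) (h _ _),
    add_mem (sub_mem (h _ _) (h _ _)) (Submodule.smul_mem _ _ (h _ _)),
    add_mem (sub_mem (h _ _) (h _ _)) (Submodule.smul_mem _ _ (h _ _))⟩

theorem relC_subset_degreePart : ∀ g ∈ relC p k, g ∈ degreePart 𝕜 (Fin 3) 2 := by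
  have h := ι_mul_ι_mem_degreePart (𝕜 := 𝕜)
  simp only [relC, Set.mem_insert_iff, Set.mem_singleton_iff, forall_eq_or_imp, forall_eq, pow_two]
  exact ⟨add_mem (h _ _) (h _ _), add_mem (h _ _) (h _ _),
    add_mem (add_mem (h _ _) (h _ _)) (Submodule.smul_mem _ _ (h _ _)), h _ _, h _ _,
    add_mem (add_mem (h _ _) (Submodule.smul_mem _ _ (h _ _))) (Submodule.smul_mem _ _ (h _ _))⟩

theorem relB_subset_degreePart : ∀ g ∈ relB p, g ∈ degreePart 𝕜 (Fin 3) 2 := fun g hg =>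
  relC_subset_degreePart (k := 0) g (by rw [relC_eq]; exact Or.inl hg)

/-- The rules for the entries of the braiding matrix on a quotient of `T(V)`. -/
theorem braidRel_quotient (hπ : Function.Surjective π) {B : Fin 3 → Fin 3 → Module.End 𝕜 A}
    (hB : ∀ i l y, B i l (π y) = π (braidLeft (c12 t a b p q k) i l y)) :
    BraidRel t a b p q k p (fun i => Algebra.lmul 𝕜 A (π (FreeAlgebra.ι 𝕜 i)))
      (B 0 0) (B 1 1) (B 2 0) (B 2 1) (B 1 1) ∧
    BraidRel t a b p q k q (fun i => LinearMap.mulRight 𝕜 (π (FreeAlgebra.ι 𝕜 i)))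
      (B 0 0) (B 1 1) (B 2 0) (B 2 1) (B 0 0) ∧
    BraidComm k (B 0 0) (B 1 1) (B 2 0) (B 2 1) := by
  have h := braidEntries_c12 t a b p q k
  have hc := h.comm
  have ext' : ∀ {f g : Module.End 𝕜 A}, (∀ y, f (π y) = g (π y)) → f = g := fun {f g} H =>
    LinearMap.ext fun z => by obtain ⟨y, rfl⟩ := hπ z; exact H y
  refine ⟨?_, ?_, ?_⟩
  · constructor <;> refine ext' fun y => ?_ <;>
      simp only [Module.End.mul_apply, Algebra.coe_lmul_eq_mul, LinearMap.mul_apply_apply,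
        LinearMap.add_apply, LinearMap.sub_apply, LinearMap.smul_apply, ← map_mul, hB, h.S_mul,
        h.T_mul, h.B_mul, h.C_mul, h.S0, h.S1, h.S2, h.T0, h.T1, h.T2, h.B0, h.B1, h.B2, h.C0,
        h.C1, h.C2, ← map_smul, ← map_add, ← map_sub] <;> congr 1 <;>
      simp only [add_mul, sub_mul, smul_mul_assoc, zero_mul] <;> module
  · constructor <;> refine ext' fun y => ?_ <;>
      simp only [Module.End.mul_apply, LinearMap.mulRight_apply,
        LinearMap.add_apply, LinearMap.sub_apply, LinearMap.smul_apply, ← map_mul, hB, h.S_mul,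
        h.T_mul, h.B_mul, h.C_mul, h.S0, h.S1, h.S2, h.T0, h.T1, h.T2, h.B0, h.B1, h.B2, h.C0,
        h.C1, h.C2, ← map_smul, ← map_add, ← map_sub] <;> congr 1 <;>
      simp only [mul_add, mul_sub, mul_smul_comm, mul_zero] <;> module
  · have hTS := fun y => LinearMap.congr_fun hc.TS y
    have hBS := fun y => LinearMap.congr_fun hc.BS y
    have hBT := fun y => LinearMap.congr_fun hc.BT y
    have hCS := fun y => LinearMap.congr_fun hc.CS y
    have hCT := fun y => LinearMap.congr_fun hc.CT y
    have hBC := fun y => LinearMap.congr_fun hc.BC y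
    simp only [Module.End.mul_apply, LinearMap.add_apply, LinearMap.sub_apply,
      LinearMap.smul_apply] at hTS hBS hBT hCS hCT hBC
    constructor <;> refine ext' fun y => ?_ <;>
      simp only [Module.End.mul_apply, LinearMap.add_apply, LinearMap.sub_apply,
        LinearMap.smul_apply, hB, hTS, hBS, hBT, hCS, hCT, hBC, map_add, map_sub, map_smul]

/-- A criterion for ideals of the rank three tensor algebra generated in degree two to be Hopf
ideals. -/
theorem isHomogeneousHopfIdeal_c12 {G : Set (FreeAlgebra 𝕜 (Fin 3))}
    (hπ : Function.Surjective π) (hker : ∀ x, π x = 0 ↔ x ∈ TwoSidedIdeal.span G)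
    (hdeg : ∀ g ∈ G, g ∈ degreePart 𝕜 (Fin 3) 2)
    (hmat : ∀ g ∈ G, ((π.mapMatrix (m := Fin 3)).comp (braidMatrix (c12 t a b p q k))) g = 0)
    (hcomul : ∀ S T B C : Module.End 𝕜 A ⊗[𝕜] A,
      BraidRel t a b p q k p (fun i => Algebra.lmul 𝕜 A (π (FreeAlgebra.ι 𝕜 i)) ⊗ₜ[𝕜] (1 : A))
        S T B C T → BraidComm k S T B C →
      CommuteAll (fun i => Algebra.lmul 𝕜 A (π (FreeAlgebra.ι 𝕜 i)) ⊗ₜ[𝕜] (1 : A))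
        (fun i => (1 : Module.End 𝕜 A) ⊗ₜ[𝕜] π (FreeAlgebra.ι 𝕜 i)) S T B C →
      ∀ g ∈ G, FreeAlgebra.lift 𝕜 (comulGen
        (fun i => Algebra.lmul 𝕜 A (π (FreeAlgebra.ι 𝕜 i)) ⊗ₜ[𝕜] (1 : A))
        (fun i => (1 : Module.End 𝕜 A) ⊗ₜ[𝕜] π (FreeAlgebra.ι 𝕜 i)) S T B C) g = 0)
    (hanti : ∀ S T B C : Module.End 𝕜 A,
      BraidRel t a b p q k q (fun i => LinearMap.mulRight 𝕜 (π (FreeAlgebra.ι 𝕜 i)))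
        S T B C S → BraidComm k S T B C →
      ∀ g ∈ G, FreeAlgebra.lift 𝕜 (antipodeGen
        (fun i => LinearMap.mulRight 𝕜 (π (FreeAlgebra.ι 𝕜 i))) S T B C) g = 0) :
    IsHomogeneousHopfIdeal (c12 t a b p q k) (TwoSidedIdeal.span G) := by
  obtain ⟨B, hB⟩ := exists_braid_quotient (c12 t a b p q k) hπ hker fun g hg i l =>
    congrFun (congrFun (hmat g hg) i) l
  obtain ⟨hL, hR, hC⟩ := braidRel_quotient hπ hB
  have h0 : ∀ i l, i ≠ 2 → l ≠ i → B i l = 0 := fun i l hi hl => LinearMap.ext fun z => by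
    obtain ⟨y, rfl⟩ := hπ z
    rw [hB, braidLeft_c12_eq_zero t a b p q k hi hl]; simp
  have h22 : B 2 2 = B 0 0 := LinearMap.ext fun z => by
    obtain ⟨y, rfl⟩ := hπ z
    rw [hB, hB, braidLeft_c12_two_two]
  have h01 := h0 0 1 (by decide) (by decide)
  have h02 := h0 0 2 (by decide) (by decide)
  have h10 := h0 1 0 (by decide) (by decide)
  have h12 := h0 1 2 (by decide) (by decide)
  refine isHomogeneousHopfIdeal_span _ hπ hker hdeg B hB ?_ ?_
  -- The vanishing entries and `h22` collapse the sums over l to the shape of `comulGen`. The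
  -- braiding entries act on the first tensor factor only, so they commute with the elements 1 ⊗
  -- x_i.
  · have := hcomul (B 0 0 ⊗ₜ 1) (B 1 1 ⊗ₜ 1) (B 2 0 ⊗ₜ 1) (B 2 1 ⊗ₜ 1) ?_ ?_ ?_
    · convert! this using 6
      rename_i i
      fin_cases i <;> simp [comulGen, Fin.sum_univ_three, h01, h02, h10, h12, h22]
    · constructor <;> simp only [Algebra.TensorProduct.tmul_mul_tmul, mul_one, hL.S0, hL.S1, hL.S2,
        hL.T0, hL.T1, hL.T2, hL.B0, hL.B1, hL.B2, hL.C0, hL.C1, hL.C2, TensorProduct.add_tmul,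
        TensorProduct.sub_tmul, TensorProduct.smul_tmul']
    · constructor <;> simp only [Algebra.TensorProduct.tmul_mul_tmul, mul_one, hC.TS, hC.BS, hC.BT,
        hC.CS, hC.CT, hC.BC, TensorProduct.add_tmul, TensorProduct.sub_tmul,
        TensorProduct.smul_tmul']
    · constructor <;> intros <;> simp
  · have := hanti (B 0 0) (B 1 1) (B 2 0) (B 2 1) hR hC
    convert! this using 6
    rename_i i
    fin_cases i <;> simp [antipodeGen, Fin.sum_univ_three, h01, h02, h10, h12, h22]

theorem SatB.braidMatrix (hX : SatB p fun i => π (FreeAlgebra.ι 𝕜 i)) :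
    SatB p fun i => ((π.mapMatrix (m := Fin 3)).comp
      (braidMatrix (c12 (-1) a (-p) p q k))) (FreeAlgebra.ι 𝕜 i) := by
  constructor <;> ext i j <;> fin_cases i <;> fin_cases j <;>
    simp [braidMatrix_ι_zero, braidMatrix_ι_one, braidMatrix_ι_two, Matrix.mul_apply,
      Fin.sum_univ_three, hX.h10, hX.h20, hX.h21, hX.h00, hX.h11, mul_add, add_mul, mul_sub] <;>
      module

theorem isHomogeneousHopfIdeal_relA (hπ : Function.Surjective π)
    (hker : ∀ x, π x = 0 ↔ x ∈ TwoSidedIdeal.span (relA p q)) :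
    IsHomogeneousHopfIdeal (c12 1 a (p - 2 * q) p q k) (TwoSidedIdeal.span (relA p q)) := by
  have hrel : ∀ g ∈ relA p q, π g = 0 := fun g hg => (hker g).2 (TwoSidedIdeal.subset_span hg)
  have hX := (forall_relA_iff π).1 hrel
  refine isHomogeneousHopfIdeal_c12 hπ hker relA_subset_degreePart ?_ ?_ ?_
  · rw [forall_relA_iff]
    constructor <;> ext i j <;> fin_cases i <;> fin_cases j <;>
      simp [braidMatrix_ι_zero, braidMatrix_ι_one, braidMatrix_ι_two, Matrix.mul_apply,
        Fin.sum_univ_three, hX.h10, hX.h20, hX.h21, mul_add, add_mul, sub_mul, mul_sub] <;> module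
  · intro S T B C hb hc hy
    refine (forall_relA_iff (E := Module.End 𝕜 A ⊗[𝕜] A) _).2 ?_
    simp only [FreeAlgebra.lift_ι_apply]
    refine SatA.comulGen hb hc hy ?_ ?_
    · exact (forall_relA_iff (E := Module.End 𝕜 A ⊗[𝕜] A)
        (Algebra.TensorProduct.includeLeft.comp ((Algebra.lmul 𝕜 A).comp π))).1
        fun g hg => by simp [hrel g hg]
    · exact (forall_relA_iff (E := Module.End 𝕜 A ⊗[𝕜] A)
        (Algebra.TensorProduct.includeRight.comp π)).1 fun g hg => by simp [hrel g hg]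
  · intro S T B C hb hc
    rw [forall_relA_iff]
    simp only [FreeAlgebra.lift_ι_apply]
    exact SatA.antipodeGen hb hc hX.mulRight

theorem isHomogeneousHopfIdeal_relB (hπ : Function.Surjective π)
    (hker : ∀ x, π x = 0 ↔ x ∈ TwoSidedIdeal.span (relB p)) :
    IsHomogeneousHopfIdeal (c12 (-1) a (-p) p q k) (TwoSidedIdeal.span (relB p)) := by
  have hrel : ∀ g ∈ relB p, π g = 0 := fun g hg => (hker g).2 (TwoSidedIdeal.subset_span hg)
  have hX := (forall_relB_iff π).1 hrel
  refine isHomogeneousHopfIdeal_c12 hπ hker relB_subset_degreePart ?_ ?_ ?_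
  · rw [forall_relB_iff]
    exact SatB.braidMatrix hX
  · intro S T B C hb hc hy
    refine (forall_relB_iff (E := Module.End 𝕜 A ⊗[𝕜] A) _).2 ?_
    simp only [FreeAlgebra.lift_ι_apply]
    refine SatB.comulGen hb hc hy ?_ ?_
    · exact (forall_relB_iff (E := Module.End 𝕜 A ⊗[𝕜] A)
        (Algebra.TensorProduct.includeLeft.comp ((Algebra.lmul 𝕜 A).comp π))).1
        fun g hg => by simp [hrel g hg]
    · exact (forall_relB_iff (E := Module.End 𝕜 A ⊗[𝕜] A)
        (Algebra.TensorProduct.includeRight.comp π)).1 fun g hg => by simp [hrel g hg]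
  · intro S T B C hb hc
    rw [forall_relB_iff]
    simp only [FreeAlgebra.lift_ι_apply]
    exact SatB.antipodeGen hb hc hX.mulRight

theorem isHomogeneousHopfIdeal_relC (hπ : Function.Surjective π)
    (hker : ∀ x, π x = 0 ↔ x ∈ TwoSidedIdeal.span (relC p k)) :
    IsHomogeneousHopfIdeal (c12 (-1) (-p ^ 2) (-p) p q k) (TwoSidedIdeal.span (relC p k)) := by
  have hrel : ∀ g ∈ relC p k, π g = 0 := fun g hg => (hker g).2 (TwoSidedIdeal.subset_span hg)
  have hX := (forall_relC_iff π).1 hrel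
  refine isHomogeneousHopfIdeal_c12 hπ hker relC_subset_degreePart ?_ ?_ ?_
  · rw [forall_relC_iff]
    refine ⟨SatB.braidMatrix hX.toSatB, ?_⟩
    ext i j
    fin_cases i <;> fin_cases j <;>
      simp [braidMatrix_ι_zero, braidMatrix_ι_one, braidMatrix_ι_two, Matrix.mul_apply,
        Fin.sum_univ_three, hX.h10, hX.h20, hX.h21, hX.h00, hX.h22, mul_add, add_mul, mul_sub] <;>
        module
  · intro S T B C hb hc hy
    refine (forall_relC_iff (E := Module.End 𝕜 A ⊗[𝕜] A) _).2 ?_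
    simp only [FreeAlgebra.lift_ι_apply]
    refine SatC.comulGen hb hc hy ?_ ?_
    · exact (forall_relC_iff (E := Module.End 𝕜 A ⊗[𝕜] A)
        (Algebra.TensorProduct.includeLeft.comp ((Algebra.lmul 𝕜 A).comp π))).1
        fun g hg => by simp [hrel g hg]
    · exact (forall_relC_iff (E := Module.End 𝕜 A ⊗[𝕜] A)
        (Algebra.TensorProduct.includeRight.comp π)).1 fun g hg => by simp [hrel g hg]
  · intro S T B C hb hc
    rw [forall_relC_iff]
    simp only [FreeAlgebra.lift_ι_apply]
    exact SatC.antipodeGen hb hc hX.mulRight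

end HopfIdealsRankThree

/-! ### Skew derivations on the quotients and triangularity for t = 1. -/

section SkewDerivations

variable {𝕜 : Type*} [Field 𝕜] {E : Type*} [Ring E] [Algebra 𝕜 E]

/-- The commutation rules between the skew derivations and left multiplications. -/
structure DerRel (t a b p q k : 𝕜) (X D : Fin 3 → E) : Prop where
  h00 : D 0 * X 0 = 1 + t • (X 0 * D 0) + (t * p) • (X 0 * D 2)
  h01 : D 0 * X 1 = t • (X 1 * D 0) + (t * q) • (X 1 * D 2)
  h02 : D 0 * X 2 = t • (X 2 * D 0) + (t * b) • (X 0 * D 0) + (t * (p - q)) • (X 1 * D 1) +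
    (t * p) • (X 2 * D 2) + (t * k) • (X 1 * D 2) + (t * a) • (X 0 * D 2)
  h10 : D 1 * X 0 = t • (X 0 * D 1)
  h11 : D 1 * X 1 = 1 + t • (X 1 * D 1)
  h12 : D 1 * X 2 = t • (X 2 * D 1) + (t * b) • (X 0 * D 1) - (t * k) • (X 0 * D 2)
  h20 : D 2 * X 0 = t • (X 0 * D 2)
  h21 : D 2 * X 1 = t • (X 1 * D 2)
  h22 : D 2 * X 2 = 1 + t • (X 2 * D 2) + (t * b) • (X 0 * D 2)

variable {t a b p q k : 𝕜} {A : Type*} [Ring A] [Algebra 𝕜 A]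
  {π : FreeAlgebra 𝕜 (Fin 3) →ₐ[𝕜] A}

theorem derRel_quotient (hπ : Function.Surjective π) {D : Fin 3 → Module.End 𝕜 A}
    (hD : ∀ i y, D i (π y) = π (skewDer (c12 t a b p q k) i y)) :
    DerRel t a b p q k (fun i => Algebra.lmul 𝕜 A (π (FreeAlgebra.ι 𝕜 i))) D := by
  have ext' : ∀ {f g : Module.End 𝕜 A}, (∀ y, f (π y) = g (π y)) → f = g := fun {f g} H =>
    LinearMap.ext fun z => by obtain ⟨y, rfl⟩ := hπ z; exact H y
  constructor <;> refine ext' fun y => ?_ <;>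
    simp only [Module.End.mul_apply, Algebra.coe_lmul_eq_mul, LinearMap.mul_apply_apply,
      LinearMap.add_apply, LinearMap.sub_apply, LinearMap.smul_apply, Module.End.one_apply,
      ← map_mul, hD, skewDer_ι_mul, ← map_smul, ← map_add, ← map_sub] <;> congr 1 <;>
    simp [Fin.sum_univ_three, c12, R12, finProdFinEquiv] <;> module

/-- Here `I` is any Hopf ideal, not the kernel of `π`: applying derivations keeps a representative
inside `I`, where the counit vanishes. This is what bounds J(V) from above. -/
theorem counit_pow_skewDer_eq_zero {D : Fin 3 → Module.End 𝕜 A} {ε : A →ₗ[𝕜] 𝕜}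
    {r : Fin 3 → Fin 3 → Fin 3 → Fin 3 → 𝕜}
    (hD : ∀ i y, D i (π y) = π (skewDer r i y))
    (hε : ∀ y, ε (π y) = FreeAlgebra.algebraMapInv y)
    {I : TwoSidedIdeal (FreeAlgebra 𝕜 (Fin 3))} (hI : IsHomogeneousHopfIdeal r I)
    {y : FreeAlgebra 𝕜 (Fin 3)} (hy : y ∈ I) (l m n : ℕ) :
    ε ((D 0 ^ l * D 1 ^ m * D 2 ^ n) (π y)) = 0 := by
  have key : ∀ i n, ∀ y ∈ I, ∃ z ∈ I, (D i ^ n) (π y) = π z := by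
    intro i n
    induction n with
    | zero => exact fun y hy => ⟨y, hy, by simp⟩
    | succ n ih =>
      intro y hy
      obtain ⟨z, hz, h⟩ := ih _ (skewDer_mem hI i hy)
      exact ⟨z, hz, by rw [pow_succ, Module.End.mul_apply, hD, h]⟩
  obtain ⟨y₂, hy₂, h₂⟩ := key 2 n y hy
  obtain ⟨y₁, hy₁, h₁⟩ := key 1 m y₂ hy₂
  obtain ⟨y₀, hy₀, h₀⟩ := key 0 l y₁ hy₁
  simp only [Module.End.mul_apply]
  rw [h₂, h₁, h₀, hε, hI.counit_eq_zero y₀ hy₀]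

/-- The monomial `x_0^{e_0} x_1^{e_1} x_2^{e_2}`. -/
def mono (X : Fin 3 → E) (e : Fin 3 → ℕ) : E := X 0 ^ e 0 * X 1 ^ e 1 * X 2 ^ e 2

/-- The functional `ε ∂_0^{n_0} ∂_1^{n_1} ∂_2^{n_2}`. -/
def derFunctional (ε : A →ₗ[𝕜] 𝕜) (D : Fin 3 → Module.End 𝕜 A) (l m n : ℕ) : A →ₗ[𝕜] 𝕜 :=
  ε ∘ₗ (D 0 ^ l * D 1 ^ m * D 2 ^ n)

theorem derFunctional_apply (ε : A →ₗ[𝕜] 𝕜) (D : Fin 3 → Module.End 𝕜 A) (l m n : ℕ) (u : A) :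
    derFunctional ε D l m n u = ε ((D 0 ^ l) ((D 1 ^ m) ((D 2 ^ n) u))) := rfl

/-- Lexicographic comparison of exponents, the last one first. -/
def lexKey (l m n : ℕ) : ℕ ×ₗ ℕ ×ₗ ℕ := toLex (n, toLex (m, l))

theorem lexKey_lt {l m n l' m' n' : ℕ} (h : lexKey l' m' n' < lexKey l m n) :
    n' < n ∨ n' = n ∧ m' < m ∨ n' = n ∧ m' = m ∧ l' < l := by
  rw [lexKey, lexKey, Prod.Lex.toLex_lt_toLex] at h
  simp only [Prod.Lex.toLex_lt_toLex] at h
  tauto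

theorem lexKey_inj {l m n l' m' n' : ℕ} (h : lexKey l' m' n' = lexKey l m n) :
    l' = l ∧ m' = m ∧ n' = n := by
  simp only [lexKey, toLex_inj, Prod.mk.injEq] at h
  tauto

/-- A Weyl-type relation perturbed by W D. It is used for ∂_2 and x_2 with W = b x_0, and for ∂_1
and x_1 with W = 0. The perturbation still ends in a power of D, so on D-constants D acts on powers
of Z as d/dZ. -/
theorem pow_mul_of_lowering {D Z W : E} (h : D * Z = 1 + Z * D + W * D) (hW : D * W = W * D)
    (n : ℕ) :
    D ^ (n + 1) * Z = ((n + 1 : ℕ) : E) * D ^ n + (Z + ((n + 1 : ℕ) : E) * W) * D ^ (n + 1)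
      := by
  induction n with
  | zero => simp [h, add_mul, add_assoc]
  | succ n ih =>
    have hW' : D ^ (n + 1) * W = W * D ^ (n + 1) := (Commute.pow_left hW (n + 1))
    rw [pow_succ, mul_assoc, h, mul_add, mul_add, ← mul_assoc, ← mul_assoc, ih, hW', mul_one]
    push_cast
    simp only [add_mul, mul_assoc, one_mul, pow_succ]
    abel

theorem pow_apply_pow_of_lt {D Z W : Module.End 𝕜 A} (h : D * Z = 1 + Z * D + W * D)
    (hW : D * W = W * D) {u : A} (hu : D u = 0) {n c : ℕ} (hc : c < n) :
    (D ^ n) ((Z ^ c) u) = 0 := by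
  induction c generalizing n with
  | zero =>
    obtain ⟨n, rfl⟩ : ∃ m, n = m + 1 := ⟨n - 1, by omega⟩
    simp [pow_succ, hu]
  | succ c ih =>
    obtain ⟨n, rfl⟩ : ∃ m, n = m + 1 := ⟨n - 1, by omega⟩
    rw [pow_succ' Z, Module.End.mul_apply, ← Module.End.mul_apply, pow_mul_of_lowering h hW]
    simp only [LinearMap.add_apply, Module.End.mul_apply, ih (show c < n by omega),
      ih (show c < n + 1 by omega), map_zero, add_zero]

theorem pow_apply_pow_self {D Z W : Module.End 𝕜 A} (h : D * Z = 1 + Z * D + W * D)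
    (hW : D * W = W * D) {u : A} (hu : D u = 0) (n : ℕ) :
    (D ^ n) ((Z ^ n) u) = (n.factorial : 𝕜) • u := by
  induction n with
  | zero => simp
  | succ n ih =>
    rw [pow_succ' Z, Module.End.mul_apply, ← Module.End.mul_apply, pow_mul_of_lowering h hW]
    simp only [LinearMap.add_apply, Module.End.mul_apply, ih,
      pow_apply_pow_of_lt h hW hu (Nat.lt_succ_self n), map_zero, add_zero,
      Module.End.natCast_apply, Nat.factorial_succ, Nat.cast_mul, mul_smul, Nat.cast_smul_eq_nsmul]

variable {X : Fin 3 → A} {D : Fin 3 → Module.End 𝕜 A} {ε : A →ₗ[𝕜] 𝕜}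

theorem mono_eq_apply (e : Fin 3 → ℕ) : mono X e =
    ((Algebra.lmul 𝕜 A (X 0)) ^ e 0) (((Algebra.lmul 𝕜 A (X 1)) ^ e 1)
      (((Algebra.lmul 𝕜 A (X 2)) ^ e 2) 1)) := by
  simp only [← map_pow]
  simp [mono, mul_assoc]

/-- Triangularity of the functionals for `t = 1`. -/
theorem derFunctional_mono_one (h : DerRel 1 a b p q k (fun i => Algebra.lmul 𝕜 A (X i)) D)
    (h1 : ∀ i, D i 1 = 0) (hε : ε 1 = 1) (e e' : Fin 3 → ℕ) :
    (lexKey (e' 0) (e' 1) (e' 2) < lexKey (e 0) (e 1) (e 2) →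
      derFunctional ε D (e 0) (e 1) (e 2) (mono X e') = 0) ∧
    derFunctional ε D (e 0) (e 1) (e 2) (mono X e) =
      ((e 0).factorial * (e 1).factorial * (e 2).factorial : 𝕜) := by
  set L : Fin 3 → Module.End 𝕜 A := fun i => Algebra.lmul 𝕜 A (X i) with hL
  have h20 : D 2 * L 0 = L 0 * D 2 := by simpa using h.h20
  have h21 : D 2 * L 1 = L 1 * D 2 := by simpa using h.h21
  have h10 : D 1 * L 0 = L 0 * D 1 := by simpa using h.h10
  have h22 : D 2 * L 2 = 1 + L 2 * D 2 + (b • L 0) * D 2 := by simpa using h.h22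
  have h2W : D 2 * (b • L 0) = (b • L 0) * D 2 := by simp [h20]
  have h11 : D 1 * L 1 = 1 + L 1 * D 1 + 0 * D 1 := by simpa using h.h11
  have h00 : D 0 * L 0 = 1 + L 0 * D 0 + p • (L 0 * D 2) := by simpa using h.h00
  have comm : ∀ i j n m u, D i * L j = L j * D i →
      (D i ^ n) ((L j ^ m) u) = (L j ^ m) ((D i ^ n) u) := by
    intro i j n m u hc
    rw [← Module.End.mul_apply, ← Module.End.mul_apply]
    exact LinearMap.congr_fun (Commute.pow_pow hc n m) u
  have low0 : ∀ j : ℕ, D 0 ((L 0 ^ (j + 1)) 1) = ((j + 1 : ℕ) : 𝕜) • (L 0 ^ j) 1 := by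
    intro j
    -- The extra term p x_0 ∂_2 in ∂_0 x_0 dies on powers of x_0, so ∂_0 differentiates these in the
    -- ordinary way.
    have hz : ∀ j, D 2 ((L 0 ^ j) 1) = 0 := fun j => by
      have := comm 2 0 1 j 1 h20
      rw [pow_one] at this
      rw [this, h1, map_zero]
    induction j with
    | zero =>
      rw [pow_succ', Module.End.mul_apply, ← Module.End.mul_apply, h00]
      simp [h1]
    | succ j ih =>
      rw [pow_succ', Module.End.mul_apply, ← Module.End.mul_apply, h00]
      simp only [LinearMap.add_apply, LinearMap.smul_apply, Module.End.mul_apply, ih, hz, map_zero,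
        smul_zero, add_zero, Module.End.one_apply, map_smul]
      rw [pow_succ', Module.End.mul_apply]
      push_cast
      module
  have hm : ∀ e, mono X e = (L 0 ^ e 0) ((L 1 ^ e 1) ((L 2 ^ e 2) 1)) := mono_eq_apply
  simp only [derFunctional_apply, hm]
  -- ∂_2 commutes with x_0 and x_1, so it reaches the power of x_2 first; after that ∂_1 and ∂_0
  -- meet only x_1 and x_0.
  rw [comm 2 0 _ _ _ h20, comm 2 0 _ _ _ h20, comm 2 1 _ _ _ h21, comm 2 1 _ _ _ h21]
  constructor
  · intro hlt
    rcases lexKey_lt hlt with h | ⟨h, h'⟩ | ⟨h, h', h''⟩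
    · rw [pow_apply_pow_of_lt h22 h2W (h1 2) h]
      simp
    · rw [h, pow_apply_pow_self h22 h2W (h1 2)]
      simp only [map_smul]
      rw [comm 1 0 _ _ _ h10, pow_apply_pow_of_lt h11 (by simp) (h1 1) h']
      simp
    · rw [h, h', pow_apply_pow_self h22 h2W (h1 2)]
      simp only [map_smul]
      rw [comm 1 0 _ _ _ h10, pow_apply_pow_self h11 (by simp) (h1 1)]
      simp only [map_smul]
      rw [pow_apply_eq_zero_of_lowering (z := fun j => (L 0 ^ j) 1) (by simp [h1]) low0 h'']
      simp
  · rw [pow_apply_pow_self h22 h2W (h1 2)]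
    simp only [map_smul]
    rw [comm 1 0 _ _ _ h10, pow_apply_pow_self h11 (by simp) (h1 1)]
    simp only [map_smul]
    rw [pow_apply_of_lowering (z := fun j => (L 0 ^ j) 1) low0]
    have : (∏ j ∈ Finset.range (e 0), ((j + 1 : ℕ) : 𝕜)) = ((e 0).factorial : 𝕜) := by
      rw [← Finset.prod_range_add_one_eq_factorial]; push_cast; rfl
    simp only [map_smul, this, pow_zero, Module.End.one_apply, hε, smul_eq_mul]
    ring

end SkewDerivations

/-! ### The element s and triangularity for t = -1. -/

section Exterior

set_option linter.unusedSimpArgs false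

variable {𝕜 : Type*} [Field 𝕜] {E : Type*} [Ring E] [Algebra 𝕜 E]

/-- The element `x_2² + k x_0 x_1 + p x_0 x_2`. -/
def quad (p k : 𝕜) (X : Fin 3 → E) : E := X 2 * X 2 + k • (X 0 * X 1) + p • (X 0 * X 2)

theorem SatB.map {F : Type*} [Ring F] [Algebra 𝕜 F] {p : 𝕜} {X : Fin 3 → E} (h : SatB p X)
    (f : E →ₐ[𝕜] F) : SatB p fun i => f (X i) := by
  constructor <;> simp only [← map_mul, ← map_neg, ← map_smul, ← map_sub, h.h10, h.h20, h.h21,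
    h.h00, h.h11, map_zero]

/-- x_0 anticommutes with x_2, hence commutes with x_2², and it annihilates the other two terms from
both sides because x_0² = 0. -/
theorem SatB.quad_mul_zero {p : 𝕜} {X : Fin 3 → E} (h : SatB p X) (k : 𝕜) :
    quad p k X * X 0 = X 0 * quad p k X := by
  simp only [quad, mul_add, add_mul, mul_assoc, mul_smul_comm, smul_mul_assoc, h.h10, h.h20,
    h.h00, mul_neg, neg_mul, mul_mul_of_eq h.h00, mul_mul_of_eq h.h20, mul_zero, zero_mul]
  module

section

variable {a p q k : 𝕜} {X D : Fin 3 → E}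

/-- Evaluated at 1 this reads ∂_0 s = -(a+p²)x_0, the scalar that separates the two cases with t =
-1. Together with the next two lemmas it makes s a constant for ∂_1 and ∂_2. -/
theorem DerRel.zero_mul_quad (h : DerRel (-1) a (-p) p q k X D) (hX : SatB p X) :
    D 0 * quad p k X = -(a + p ^ 2) • X 0 + quad p k X * D 0 + (2 * p) • (quad p k X * D 2) := by
  simp only [quad, mul_add, add_mul, mul_sub, sub_mul, mul_assoc, mul_smul_comm, smul_mul_assoc,
    h.h00, h.h01, h.h02, h.h12, h.h21, h.h22, mul_mul_of_eq h.h00, mul_mul_of_eq h.h02, hX.h10,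
    hX.h20,
    hX.h21, hX.h00, mul_neg, neg_mul, mul_mul_of_eq hX.h00, mul_mul_of_eq hX.h20,
    mul_mul_of_eq hX.h10, mul_mul_of_eq hX.h21, mul_zero, zero_mul, mul_one, one_mul]
  module

theorem DerRel.one_mul_quad (h : DerRel (-1) a (-p) p q k X D) (hX : SatB p X) :
    D 1 * quad p k X = quad p k X * D 1 := by
  simp only [quad, mul_add, add_mul, mul_sub, sub_mul, mul_assoc, mul_smul_comm, smul_mul_assoc,
    h.h10, h.h11, h.h12, h.h22, mul_mul_of_eq h.h10, mul_mul_of_eq h.h12, hX.h10, hX.h20,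
    hX.h21, hX.h00, mul_neg, neg_mul, mul_mul_of_eq hX.h00, mul_mul_of_eq hX.h20,
    mul_mul_of_eq hX.h10, mul_mul_of_eq hX.h21, mul_zero, zero_mul, mul_one, one_mul]
  module

theorem DerRel.two_mul_quad (h : DerRel (-1) a (-p) p q k X D) (hX : SatB p X) :
    D 2 * quad p k X = quad p k X * D 2 := by
  simp only [quad, mul_add, add_mul, mul_assoc, mul_smul_comm, smul_mul_assoc,
    h.h20, h.h21, h.h22, mul_mul_of_eq h.h20, mul_mul_of_eq h.h22, hX.h10, hX.h20,
    hX.h21, hX.h00, mul_neg, neg_mul, mul_mul_of_eq hX.h00, mul_mul_of_eq hX.h20,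
    mul_mul_of_eq hX.h10, mul_mul_of_eq hX.h21, mul_zero, zero_mul, mul_one, one_mul]
  module

end

variable {a p q k : 𝕜} {A : Type*} [Ring A] [Algebra 𝕜 A] {X : Fin 3 → A}
  {D : Fin 3 → Module.End 𝕜 A} {ε : A →ₗ[𝕜] 𝕜}

/-- The monomials `s^{⌊e_2/2⌋} x_0^{e_0} x_1^{e_1} x_2^{e_2 mod 2}` with `s = quad p k X`. -/
def quadMono (p k : 𝕜) (X : Fin 3 → E) (e : Fin 3 → ℕ) : E :=
  quad p k X ^ (e 2 / 2) * (X 0 ^ e 0 * X 1 ^ e 1 * X 2 ^ (e 2 % 2))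

/-- The scalars by which `∂_0` acts along the chain `1, x_0, s, s x_0, s², …`. -/
def chainCoeff (μ : 𝕜) (j : ℕ) : 𝕜 := if j % 2 = 0 then 1 else -(((j / 2 + 1 : ℕ) : 𝕜) * μ)

/-- Triangularity of the functionals for `t = -1`. -/
theorem derFunctional_quadMono
    (h : DerRel (-1) a (-p) p q k (fun i => Algebra.lmul 𝕜 A (X i)) D) (hX : SatB p X)
    (h1 : ∀ i, D i 1 = 0) (hε : ε 1 = 1) {e e' : Fin 3 → ℕ} (he : e ∈ B1) (he' : e' ∈ B1) :
    (lexKey (2 * (e' 2 / 2) + e' 0) (e' 1) (e' 2 % 2) <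
        lexKey (2 * (e 2 / 2) + e 0) (e 1) (e 2 % 2) →
      derFunctional ε D (2 * (e 2 / 2) + e 0) (e 1) (e 2 % 2) (quadMono p k X e') = 0) ∧
    ∃ n : ℕ, derFunctional ε D (2 * (e 2 / 2) + e 0) (e 1) (e 2 % 2) (quadMono p k X e) =
      (-1) ^ n * ∏ j ∈ Finset.range (2 * (e 2 / 2) + e 0), chainCoeff (a + p ^ 2) j := by
  have hL := hX.map (Algebra.lmul 𝕜 A)
  set s := quad p k X with hs
  have hS : quad p k (fun i => Algebra.lmul 𝕜 A (X i)) = Algebra.lmul 𝕜 A s := by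
    simp only [quad, hs, map_add, map_mul, map_smul]
  have d0s : ∀ u, D 0 (s * u) = -((a + p ^ 2) • (X 0 * u)) + s * D 0 u + (2 * p) • (s * D 2 u) := by
    intro u
    have := LinearMap.congr_fun (h.zero_mul_quad hL) u
    rw [hS] at this
    simpa only [Module.End.mul_apply, Algebra.coe_lmul_eq_mul, LinearMap.mul_apply_apply,
      LinearMap.add_apply, LinearMap.smul_apply, neg_smul, LinearMap.neg_apply] using this
  have d1s : ∀ u, D 1 (s * u) = s * D 1 u := by
    intro u
    have := LinearMap.congr_fun (h.one_mul_quad hL) u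
    rw [hS] at this
    simpa using this
  have d2s : ∀ u, D 2 (s * u) = s * D 2 u := by
    intro u
    have := LinearMap.congr_fun (h.two_mul_quad hL) u
    rw [hS] at this
    simpa using this
  have d00 : ∀ u, D 0 (X 0 * u) = u - X 0 * D 0 u - p • (X 0 * D 2 u) := by
    intro u
    have := LinearMap.congr_fun h.h00 u
    simp only [Module.End.mul_apply, Algebra.coe_lmul_eq_mul, LinearMap.mul_apply_apply,
      LinearMap.add_apply, LinearMap.smul_apply, Module.End.one_apply] at this
    rw [this]; module
  have d10 : ∀ u, D 1 (X 0 * u) = -(X 0 * D 1 u) := by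
    intro u; simpa using LinearMap.congr_fun h.h10 u
  have d11 : ∀ u, D 1 (X 1 * u) = u - X 1 * D 1 u := by
    intro u; simpa [sub_eq_add_neg] using LinearMap.congr_fun h.h11 u
  have d20 : ∀ u, D 2 (X 0 * u) = -(X 0 * D 2 u) := by
    intro u; simpa using LinearMap.congr_fun h.h20 u
  have d21 : ∀ u, D 2 (X 1 * u) = -(X 1 * D 2 u) := by
    intro u; simpa using LinearMap.congr_fun h.h21 u
  have d22 : D 2 (X 2) = 1 := by
    have := LinearMap.congr_fun h.h22 1
    simpa [h1] using this
  have d11' : D 1 (X 1) = 1 := by simpa [h1] using d11 1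
  have d2z : ∀ i : Fin 3, i ≠ 2 → D 2 (X i) = 0 := by
    intro i hi
    fin_cases i
    · simpa [h1] using d20 1
    · simpa [h1] using d21 1
    · exact absurd rfl hi
  have d20' := d2z 0 (by decide)
  have d21' := d2z 1 (by decide)
  have d10' : D 1 (X 0) = 0 := by simpa [h1] using d10 1
  have d1sm : ∀ m u, D 1 (s ^ m * u) = s ^ m * D 1 u := by
    intro m u
    induction m with
    | zero => simp
    | succ m ih => rw [pow_succ', mul_assoc, d1s, ih, mul_assoc]
  have d2sm : ∀ m u, D 2 (s ^ m * u) = s ^ m * D 2 u := by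
    intro m u
    induction m with
    | zero => simp
    | succ m ih => rw [pow_succ', mul_assoc, d2s, ih, mul_assoc]
  have d2sm' : ∀ m, D 2 (s ^ m) = 0 := fun m => by simpa [h1] using d2sm m 1
  have s0 : ∀ m, s ^ m * X 0 = X 0 * s ^ m := fun m =>
    (Commute.pow_left (hX.quad_mul_zero k) m)
  -- The correction 2p s ∂_2 vanishes on powers of s, and s commutes with x_0, so each of the m + 1
  -- factors contributes equally.
  have d0sm : ∀ m : ℕ, D 0 (s ^ (m + 1)) = -(((m + 1 : ℕ) : 𝕜) * (a + p ^ 2)) • (s ^ m * X 0) := by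
    intro m
    induction m with
    | zero =>
      have := d0s 1
      simp only [mul_one, h1, mul_zero, smul_zero, add_zero] at this
      rw [zero_add, pow_one, this, pow_zero, one_mul]
      push_cast
      module
    | succ m ih =>
      rw [pow_succ', d0s, ih, d2sm', s0, mul_zero, smul_zero, s0, mul_smul_comm, ← mul_assoc,
        hX.quad_mul_zero k, mul_assoc, ← hs, ← pow_succ']
      push_cast
      module
  -- The chain 1, x_0, s, s x_0, …; the element s^m x_0^c has position 2m + c, which is the exponent
  -- of ∂_0 in the functionals.
  let z : ℕ → A := fun j => s ^ (j / 2) * X 0 ^ (j % 2)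
  have hz0 : D 0 (z 0) = 0 := by simp [z, h1]
  have hz : ∀ j, D 0 (z (j + 1)) = chainCoeff (a + p ^ 2) j • z j := by
    intro j
    rcases Nat.even_or_odd' j with ⟨m, rfl | rfl⟩
    · have e1 : (2 * m + 1) / 2 = m := by omega
      have e2 : (2 * m + 1) % 2 = 1 := by omega
      have e3 : (2 * m) / 2 = m := by omega
      have e4 : (2 * m) % 2 = 0 := by omega
      simp only [z, e1, e2, e3, e4, chainCoeff, pow_one, pow_zero, mul_one, if_true, one_smul]
      rw [s0, d00, d2sm', mul_zero, smul_zero, sub_zero]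
      cases m with
      | zero => simp [h1]
      -- ∂_0(s^{m+1}) is a multiple of x_0 s^m, so multiplying it by x_0 gives zero.
      | succ m => rw [d0sm, s0, mul_smul_comm, ← mul_assoc, hX.h00]; simp
    · have e1 : (2 * m + 1 + 1) / 2 = m + 1 := by omega
      have e2 : (2 * m + 1 + 1) % 2 = 0 := by omega
      have e3 : (2 * m + 1) / 2 = m := by omega
      have e4 : (2 * m + 1) % 2 = 1 := by omega
      simp only [z, e1, e2, e3, e4, chainCoeff, pow_one, pow_zero, mul_one, one_ne_zero, if_false]
      exact d0sm m
  have zeq : ∀ m c, c < 2 → s ^ m * X 0 ^ c = z (2 * m + c) := by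
    intro m c hc
    have e1 : (2 * m + c) / 2 = m := by omega
    have e2 : (2 * m + c) % 2 = c := by omega
    simp only [z, e1, e2]
  -- removal of `x_2` by `∂_2`, and of `x_1` by `∂_1`
  have D2lt : ∀ m a b, a < 2 → b < 2 → D 2 (s ^ m * (X 0 ^ a * X 1 ^ b)) = 0 := by
    intro m a b ha hb
    rw [d2sm]
    interval_cases a <;> interval_cases b <;> simp [h1, d20, d21', d20']
  have D2eq : ∀ c m a b, c < 2 → a < 2 → b < 2 → ∃ n : ℕ,
      (D 2 ^ c) (s ^ m * (X 0 ^ a * X 1 ^ b * X 2 ^ c)) =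
        (-1 : 𝕜) ^ n • (s ^ m * (X 0 ^ a * X 1 ^ b)) := by
    intro c m a b hc ha hb
    -- ∂_2 changes sign once for each x_0 or x_1 that it passes.
    refine ⟨c * (a + b), ?_⟩
    interval_cases c
    · simp
    · rw [pow_one, d2sm]
      interval_cases a <;> interval_cases b <;> simp [mul_assoc, d20, d21, d22]
  have D1lt : ∀ m a, a < 2 → D 1 (s ^ m * X 0 ^ a) = 0 := by
    intro m a ha
    rw [d1sm]
    interval_cases a <;> simp [h1, d10']
  have D1eq : ∀ b m a, b < 2 → a < 2 → ∃ n : ℕ,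
      (D 1 ^ b) (s ^ m * (X 0 ^ a * X 1 ^ b)) = (-1 : 𝕜) ^ n • (s ^ m * X 0 ^ a) := by
    intro b m a hb ha
    refine ⟨b * a, ?_⟩
    interval_cases b
    · simp
    · rw [pow_one, d1sm]
      interval_cases a <;> simp [d10, d11']
  simp only [derFunctional_apply, quadMono, ← hs]
  constructor
  · intro hlt
    rcases lexKey_lt hlt with h | ⟨h, h'⟩ | ⟨h, h', h''⟩
    · have hc : e 2 % 2 = 1 := by omega
      have hc' : e' 2 % 2 = 0 := by omega
      rw [hc, hc', pow_one, pow_zero, mul_one, D2lt _ _ _ he'.1 he'.2]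
      simp
    · obtain ⟨n, hn⟩ := D2eq (e' 2 % 2) (e' 2 / 2) (e' 0) (e' 1) (by omega) he'.1 he'.2
      have hb : e 1 = 1 := by have := he.2; omega
      have hb' : e' 1 = 0 := by omega
      rw [← h, hn, hb, hb', pow_one, pow_zero, mul_one, map_smul, D1lt _ _ he'.1]
      simp
    · obtain ⟨n, hn⟩ := D2eq (e' 2 % 2) (e' 2 / 2) (e' 0) (e' 1) (by omega) he'.1 he'.2
      obtain ⟨n', hn'⟩ := D1eq (e' 1) (e' 2 / 2) (e' 0) he'.2 he'.1
      rw [← h, hn, map_smul, ← h', hn', zeq _ _ he'.1]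
      simp only [map_smul]
      rw [pow_apply_eq_zero_of_lowering hz0 hz h'']
      simp
  · obtain ⟨n, hn⟩ := D2eq (e 2 % 2) (e 2 / 2) (e 0) (e 1) (by omega) he.1 he.2
    obtain ⟨n', hn'⟩ := D1eq (e 1) (e 2 / 2) (e 0) he.2 he.1
    refine ⟨n + n', ?_⟩
    rw [hn, map_smul, hn', zeq _ _ he.1]
    simp only [map_smul]
    rw [pow_apply_of_lowering hz]
    simp only [map_smul, z, smul_eq_mul, Nat.zero_div, Nat.zero_mod, pow_zero, mul_one, hε]
    ring

end Exterior

/-! ### Gelfand-Kirillov dimension from a filtration of polynomial growth. -/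

section GKDimension

open Filter Topology

/-- The logarithm of a bound C n^d is log C + d log n; the constant disappears in the limit. -/
theorem tendsto_log_div_log (c : ℝ) (d : ℕ) :
    Tendsto (fun n : ℕ => (((c + d * Real.log n) / Real.log n : ℝ) : EReal)) atTop
      (𝓝 (d : EReal)) := by
  have hlog : Tendsto (fun n : ℕ => Real.log n) atTop atTop :=
    Real.tendsto_log_atTop.comp tendsto_natCast_atTop_atTop
  have h : Tendsto (fun n : ℕ => (c + d * Real.log n) / Real.log n) atTop (𝓝 (d : ℝ)) := by
    have h0 : Tendsto (fun n : ℕ => c / Real.log n + d) atTop (𝓝 (0 + d)) :=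
      (hlog.const_div_atTop c).add tendsto_const_nhds
    rw [zero_add] at h0
    refine h0.congr' ?_
    filter_upwards [hlog.eventually_gt_atTop 0] with n hn
    field_simp
  exact (continuous_coe_real_ereal.tendsto _).comp h

variable {𝕜 A : Type*} [Field 𝕜] [Ring A] [Algebra 𝕜 A]

/-- The Gelfand-Kirillov dimension of an algebra with a multiplicative filtration that is generated
by its first piece and has polynomial growth of degree `d`. -/
theorem gkDim_eq_of_filtration (F : ℕ → Submodule 𝕜 A) (hmono : Monotone F)
    (h1 : 1 ∈ F 0) (hmul : ∀ i j, F i * F j ≤ F (i + j)) (hex : ∀ u, ∃ n, u ∈ F n)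
    (hfin : ∀ n, (F n).FG) (hgen : ∀ n, F n ≤ F 1 ^ n) (d : ℕ) {C : ℝ} (hC : 1 ≤ C)
    (hup : ∀ n, (Module.finrank 𝕜 (F n) : ℝ) ≤ C * (n + 1) ^ d) {c : ℝ} (hc : 0 < c)
    (hlow : ∀ n : ℕ, c * (n : ℝ) ^ d ≤ Module.finrank 𝕜 (F n)) :
    gkDim 𝕜 A = d := by
  have hfd : ∀ n, FiniteDimensional 𝕜 (F n) := fun n =>
    Module.Finite.iff_fg.2 (hfin n)
  have hpow : ∀ (W : Submodule 𝕜 A) N, W ≤ F N → ∀ i, W ^ i ≤ F (N * i) := by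
    intro W N hW i
    induction i with
    | zero => rw [pow_zero, mul_zero, Submodule.one_le]; exact h1
    | succ i ih =>
      rw [pow_succ, mul_add, mul_one]
      exact (mul_le_mul' ih hW).trans (hmul _ _)
  have hsup : ∀ (W : Submodule 𝕜 A) N, W ≤ F N → ∀ n,
      (⨆ i ∈ Finset.range (n + 1), W ^ i) ≤ F (N * n) := by
    intro W N hW n
    refine iSup₂_le fun i hi => (hpow W N hW i).trans (hmono ?_)
    exact Nat.mul_le_mul_left N (Nat.lt_succ_iff.1 (Finset.mem_range.1 hi))
  have hlog : Tendsto (fun n : ℕ => Real.log n) atTop atTop :=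
    Real.tendsto_log_atTop.comp tendsto_natCast_atTop_atTop
  apply le_antisymm
  · refine iSup₂_le fun W hW => ?_
    obtain ⟨N, hN⟩ : ∃ N, W ≤ F N := by
      obtain ⟨s, rfl⟩ := hW
      choose f hf using hex
      refine ⟨s.sup f, Submodule.span_le.2 fun u hu => ?_⟩
      exact hmono (Finset.le_sup hu) (hf u)
    -- W^0 + … + W^n lies in F(Nn), and C(Nn+1)^d ≤ C(N+1)^d n^d for n ≥ 1.
    rw [← (tendsto_log_div_log (Real.log (C * (N + 1) ^ d)) d).limsup_eq]
    refine limsup_le_limsup ?_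
    filter_upwards [hlog.eventually_gt_atTop 0, eventually_ge_atTop 1] with n hn hn1
    rw [EReal.coe_le_coe_iff]
    refine div_le_div_of_nonneg_right ?_ hn.le
    have hn1' : (1 : ℝ) ≤ n := by exact_mod_cast hn1
    have hbound : (Module.finrank 𝕜 (⨆ i ∈ Finset.range (n + 1), W ^ i : Submodule 𝕜 A) : ℝ) ≤
        C * (N + 1) ^ d * (n : ℝ) ^ d := by
      calc (Module.finrank 𝕜 (⨆ i ∈ Finset.range (n + 1), W ^ i : Submodule 𝕜 A) : ℝ)
          ≤ Module.finrank 𝕜 (F (N * n)) := by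
            exact_mod_cast Submodule.finrank_mono (hsup W N hN n)
        _ ≤ C * ((N * n : ℕ) + 1) ^ d := hup _
        _ ≤ C * ((N + 1) * n) ^ d := by
            gcongr
            push_cast
            nlinarith
        _ = _ := by rw [mul_pow]; ring
    have hC' : 1 ≤ C * ((N : ℝ) + 1) ^ d :=
      one_le_mul_of_one_le_of_one_le hC (one_le_pow₀ (by simp))
    rw [← Real.log_pow, ← Real.log_mul (by positivity) (by positivity)]
    -- A zero dimension is separated because `Real.log 0 = 0`, outside the range where `log` is
    -- monotone.
    rcases Nat.eq_zero_or_pos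
      (Module.finrank 𝕜 (⨆ i ∈ Finset.range (n + 1), W ^ i : Submodule 𝕜 A)) with h0 | h0
    · rw [h0, Nat.cast_zero, Real.log_zero]
      exact Real.log_nonneg (one_le_mul_of_one_le_of_one_le hC' (one_le_pow₀ hn1'))
    · exact Real.log_le_log (by exact_mod_cast h0) hbound
  -- The first filtration piece attains the supremum, since its n-th power contains F(n).
  · refine le_trans ?_ (le_iSup₂ (f := fun (W : Submodule 𝕜 A) (_ : W.FG) => limsup (fun n : ℕ =>
      ((Real.log (Module.finrank 𝕜 (⨆ i ∈ Finset.range (n + 1), W ^ i : Submodule 𝕜 A)) /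
        Real.log n : ℝ) : EReal)) atTop) (F 1) (hfin 1))
    rw [← (tendsto_log_div_log (Real.log c) d).limsup_eq]
    refine limsup_le_limsup ?_
    filter_upwards [hlog.eventually_gt_atTop 0, eventually_ge_atTop 1] with n hn hn1
    rw [EReal.coe_le_coe_iff]
    refine div_le_div_of_nonneg_right ?_ hn.le
    have hn1' : (0 : ℝ) < n := by exact_mod_cast hn1
    rw [← Real.log_pow, ← Real.log_mul hc.ne' (by positivity)]
    refine Real.log_le_log (by positivity) ((hlow n).trans ?_)
    -- Needed for finite-dimensionality: `Module.finrank` is 0 on infinite-dimensional spaces, so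
    -- monotonicity would fail.
    have hle : (⨆ i ∈ Finset.range (n + 1), F 1 ^ i : Submodule 𝕜 A) ≤ F n := by
      simpa using hsup (F 1) 1 le_rfl n
    have : FiniteDimensional 𝕜 (⨆ i ∈ Finset.range (n + 1), F 1 ^ i : Submodule 𝕜 A) :=
      Submodule.finiteDimensional_of_le hle
    exact_mod_cast Submodule.finrank_mono ((hgen n).trans
      (le_iSup₂ (f := fun i (_ : i ∈ Finset.range (n + 1)) => F 1 ^ i) n (by simp)))

end GKDimension

/-! ### Filtrations by ordered monomials. -/

section Straightening

variable {𝕜 A : Type*} [Field 𝕜] [Ring A] [Algebra 𝕜 A]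

variable (𝕜) in
/-- The span of the monomials with exponents in `E` of total degree at most `n`. -/
def monoFilt (X : Fin 3 → A) (E : Set (Fin 3 → ℕ)) (n : ℕ) : Submodule 𝕜 A :=
  Submodule.span 𝕜 (mono X '' {e | e ∈ E ∧ e 0 + e 1 + e 2 ≤ n})

variable (𝕜) in
/-- The monomials with exponents in `E` are stable under left multiplication by the generators, up
to linear combinations, compatibly with degrees. -/
structure IsStraight (X : Fin 3 → A) (E : Set (Fin 3 → ℕ)) : Prop where
  zero_mem : 0 ∈ E
  mul_mem : ∀ i, ∀ e ∈ E, X i * mono X e ∈ monoFilt 𝕜 X E (e 0 + e 1 + e 2 + 1)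

variable {X : Fin 3 → A} {E : Set (Fin 3 → ℕ)}

theorem mono_mem_monoFilt {e : Fin 3 → ℕ} (he : e ∈ E) {n : ℕ} (hn : e 0 + e 1 + e 2 ≤ n) :
    mono X e ∈ monoFilt 𝕜 X E n :=
  Submodule.subset_span ⟨e, ⟨he, hn⟩, rfl⟩

theorem monoFilt_monotone : Monotone (monoFilt 𝕜 X E) := fun _ _ h =>
  Submodule.span_mono (Set.image_mono fun _ he => ⟨he.1, he.2.trans h⟩)

theorem IsStraight.one_mem (h : IsStraight 𝕜 X E) : 1 ∈ monoFilt 𝕜 X E 0 := by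
  simpa [mono] using mono_mem_monoFilt (𝕜 := 𝕜) (X := X) h.zero_mem (n := 0) (by simp)

theorem IsStraight.gen_mul_mem (h : IsStraight 𝕜 X E) (i : Fin 3) {n : ℕ} {u : A}
    (hu : u ∈ monoFilt 𝕜 X E n) : X i * u ∈ monoFilt 𝕜 X E (n + 1) := by
  induction hu using Submodule.span_induction with
  | mem u hu =>
    obtain ⟨e, ⟨he, hn⟩, rfl⟩ := hu
    exact monoFilt_monotone (by omega) (h.mul_mem i e he)
  | zero => simp
  | add u v _ _ hu hv => rw [mul_add]; exact add_mem hu hv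
  | smul c u _ hu => rw [mul_smul_comm]; exact Submodule.smul_mem _ _ hu

theorem IsStraight.mono_mul_mem (h : IsStraight 𝕜 X E) (e : Fin 3 → ℕ) {n : ℕ} {u : A}
    (hu : u ∈ monoFilt 𝕜 X E n) : mono X e * u ∈ monoFilt 𝕜 X E (e 0 + e 1 + e 2 + n) := by
  have key : ∀ i c n u, u ∈ monoFilt 𝕜 X E n → X i ^ c * u ∈ monoFilt 𝕜 X E (c + n) := by
    intro i c
    induction c with
    | zero => intro n u hu; simpa using hu
    | succ c ih =>
      intro n u hu
      rw [pow_succ', mul_assoc, show c + 1 + n = c + n + 1 by omega]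
      exact h.gen_mul_mem i (ih n u hu)
  rw [mono, mul_assoc, mul_assoc, add_assoc, add_assoc]
  exact key _ _ _ _ (key _ _ _ _ (key _ _ _ _ hu))

theorem IsStraight.mul_le (h : IsStraight 𝕜 X E) (i j : ℕ) :
    monoFilt 𝕜 X E i * monoFilt 𝕜 X E j ≤ monoFilt 𝕜 X E (i + j) := by
  rw [Submodule.mul_le]
  intro u hu v hv
  induction hu using Submodule.span_induction with
  | mem u hu =>
    obtain ⟨e, ⟨he, hn⟩, rfl⟩ := hu
    exact monoFilt_monotone (by omega) (h.mono_mul_mem e hv)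
  | zero => simp
  | add u v _ _ hu hv => rw [add_mul]; exact add_mem hu hv
  | smul c u _ hu => rw [smul_mul_assoc]; exact Submodule.smul_mem _ _ hu

theorem monoFilt_le_span (n : ℕ) : monoFilt 𝕜 X E n ≤
    Submodule.span 𝕜 (Set.range fun e : E => mono X e.1) := by
  refine Submodule.span_mono ?_
  rintro _ ⟨e, he, rfl⟩
  exact ⟨⟨e, he.1⟩, rfl⟩

/-- The monomials span an algebra generated by the `X i`. -/
theorem IsStraight.span_eq_top (h : IsStraight 𝕜 X E) {π : FreeAlgebra 𝕜 (Fin 3) →ₐ[𝕜] A}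
    (hπ : Function.Surjective π) (hX : ∀ i, π (FreeAlgebra.ι 𝕜 i) = X i) :
    Submodule.span 𝕜 (Set.range fun e : E => mono X e.1) = ⊤ := by
  refine eq_top_iff.2 fun u _ => ?_
  obtain ⟨y, rfl⟩ := hπ u
  refine mem_of_mulLeft_stable
    ((Submodule.span 𝕜 (Set.range fun e : E => mono X e.1)).comap π.toLinearMap) ?_ ?_ y
  · simpa using monoFilt_le_span 0 h.one_mem
  · intro i y hy
    simp only [Submodule.mem_comap, AlgHom.toLinearMap_apply, map_mul, hX] at hy ⊢
    generalize π y = v at hy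
    induction hy using Submodule.span_induction with
    | mem u hu =>
      obtain ⟨e, rfl⟩ := hu
      exact monoFilt_le_span _ (h.mul_mem i e.1 e.2)
    | zero => simp
    | add u v _ _ hu hv => rw [mul_add]; exact add_mem hu hv
    | smul c u _ hu => rw [mul_smul_comm]; exact Submodule.smul_mem _ _ hu

theorem exists_mem_monoFilt (hspan : Submodule.span 𝕜 (Set.range fun e : E => mono X e.1) = ⊤)
    (u : A) : ∃ n, u ∈ monoFilt 𝕜 X E n := by
  have hu : u ∈ Submodule.span 𝕜 (Set.range fun e : E => mono X e.1) :=
    hspan ▸ Submodule.mem_top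
  induction hu using Submodule.span_induction with
  | mem u hu => obtain ⟨e, rfl⟩ := hu; exact ⟨_, mono_mem_monoFilt e.2 le_rfl⟩
  | zero => exact ⟨0, zero_mem _⟩
  | add u v _ _ hu hv =>
    obtain ⟨m, hm⟩ := hu
    obtain ⟨n, hn⟩ := hv
    exact ⟨max m n, add_mem (monoFilt_monotone (le_max_left _ _) hm)
      (monoFilt_monotone (le_max_right _ _) hn)⟩
  | smul c u _ hu => obtain ⟨n, hn⟩ := hu; exact ⟨n, Submodule.smul_mem _ _ hn⟩

theorem monoFilt_fg (n : ℕ) : (monoFilt 𝕜 X E n).FG := by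
  refine Submodule.fg_span (Set.Finite.image _ ?_)
  refine (Set.finite_Iic (fun _ : Fin 3 => n)).subset fun e he i => ?_
  have := he.2
  fin_cases i <;> simp only [Fin.zero_eta, Fin.mk_one, Fin.reduceFinMk] <;> omega

/-- An ordered monomial is a product of as many generators as its degree, and 1 ∈ F(1) pads shorter
products. -/
theorem IsStraight.le_pow (h : IsStraight 𝕜 X E) (n : ℕ) :
    monoFilt 𝕜 X E n ≤ monoFilt 𝕜 X E 1 ^ n := by
  have hone : (1 : A) ∈ monoFilt 𝕜 X E 1 := monoFilt_monotone (Nat.zero_le 1) h.one_mem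
  have hgen : ∀ i, X i ∈ monoFilt 𝕜 X E 1 := fun i => by
    simpa using h.gen_mul_mem i h.one_mem
  have hle : ∀ m n, m ≤ n → monoFilt 𝕜 X E 1 ^ m ≤ monoFilt 𝕜 X E 1 ^ n := fun m n hmn =>
    pow_le_pow_right₀ (Submodule.one_le.2 hone) hmn
  refine Submodule.span_le.2 ?_
  rintro _ ⟨e, ⟨he, hn⟩, rfl⟩
  refine hle _ _ hn ?_
  rw [pow_add, pow_add]
  exact Submodule.mul_mem_mul (Submodule.mul_mem_mul (Submodule.pow_mem_pow _ (hgen 0) _)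
    (Submodule.pow_mem_pow _ (hgen 1) _)) (Submodule.pow_mem_pow _ (hgen 2) _)

/-- The Gelfand-Kirillov dimension of an algebra with a basis of monomials, from bounds on the
number of monomials of bounded degree. -/
theorem IsStraight.gkDim_eq (h : IsStraight 𝕜 X E)
    (hspan : Submodule.span 𝕜 (Set.range fun e : E => mono X e.1) = ⊤)
    (hli : LinearIndependent 𝕜 fun e : E => mono X e.1) (d : ℕ) {C : ℝ} (hC : 1 ≤ C)
    (hup : ∀ n, ∃ s : Finset (Fin 3 → ℕ), {e | e ∈ E ∧ e 0 + e 1 + e 2 ≤ n} ⊆ s ∧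
      (s.card : ℝ) ≤ C * (n + 1) ^ d) {c : ℝ} (hc : 0 < c)
    (hlow : ∀ n : ℕ, ∃ s : Finset (Fin 3 → ℕ), (s : Set (Fin 3 → ℕ)) ⊆
      {e | e ∈ E ∧ e 0 + e 1 + e 2 ≤ n} ∧ c * (n : ℝ) ^ d ≤ s.card) :
    gkDim 𝕜 A = d := by
  classical
  have hfd : ∀ n, FiniteDimensional 𝕜 (monoFilt 𝕜 X E n) := fun n =>
    Module.Finite.iff_fg.2 (monoFilt_fg n)
  refine gkDim_eq_of_filtration (monoFilt 𝕜 X E) monoFilt_monotone h.one_mem h.mul_le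
    (exists_mem_monoFilt hspan) monoFilt_fg h.le_pow d hC ?_ hc ?_
  · intro n
    obtain ⟨s, hs, hcard⟩ := hup n
    refine le_trans ?_ hcard
    have hle : monoFilt 𝕜 X E n ≤ Submodule.span 𝕜 ((s.image (mono X) : Finset A) : Set A) := by
      refine Submodule.span_mono ?_
      rw [Finset.coe_image]
      exact Set.image_mono hs
    exact_mod_cast (Submodule.finrank_mono hle).trans
      ((finrank_span_finset_le_card _).trans Finset.card_image_le)
  · intro n
    obtain ⟨s, hs, hcard⟩ := hlow n
    refine hcard.trans ?_
    have hli' : LinearIndependent 𝕜 fun e : s => mono X e.1 :=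
      hli.comp (fun e : s => (⟨e.1, (hs e.2).1⟩ : E)) fun e e' hee => by
        exact Subtype.ext (congrArg Subtype.val hee :)
    have hle : Submodule.span 𝕜 (Set.range fun e : s => mono X e.1) ≤ monoFilt 𝕜 X E n := by
      refine Submodule.span_le.2 ?_
      rintro _ ⟨e, rfl⟩
      exact mono_mem_monoFilt (hs e.2).1 (hs e.2).2
    have := Submodule.finrank_mono hle
    rw [finrank_span_eq_card hli', Fintype.card_coe] at this
    exact_mod_cast this

end Straightening

/-! ### Straightening for the three sets of relations, and change of basis. -/

section MonomialBases

variable {𝕜 A : Type*} [Field 𝕜] [Ring A] [Algebra 𝕜 A] {X : Fin 3 → A} {E : Set (Fin 3 → ℕ)}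

theorem mono_vec (l m n : ℕ) : mono X ![l, m, n] = X 0 ^ l * X 1 ^ m * X 2 ^ n := rfl

/-- Moving x_2 past x_0^l x_1^m only produces corrections in which x_2 is replaced by x_0, so the
degree never grows. -/
theorem SatA.isStraight {p q : 𝕜} (h : SatA p q X) : IsStraight 𝕜 X B3 := by
  have h10 : ∀ l, X 1 * X 0 ^ l = X 0 ^ l * X 1 := fun l => Commute.pow_right h.h10 l
  have h20 : ∀ l : ℕ, X 2 * X 0 ^ l = X 0 ^ l * X 2 - (l * q : 𝕜) • X 0 ^ (l + 1) := by
    intro l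
    induction l with
    | zero => simp
    | succ l ih =>
      rw [pow_succ, ← mul_assoc, ih, sub_mul, mul_assoc, h.h20, mul_sub, smul_mul_assoc,
        mul_smul_comm, ← mul_assoc, ← mul_assoc, ← pow_succ, ← pow_succ]
      push_cast
      module
  have h21 : ∀ m : ℕ, X 2 * X 1 ^ m =
      X 1 ^ m * X 2 + (m * (p - 2 * q) : 𝕜) • (X 0 * X 1 ^ m) := by
    intro m
    induction m with
    | zero => simp
    | succ m ih =>
      have h10' : X 1 ^ m * X 0 = X 0 * X 1 ^ m := Commute.pow_left h.h10 m
      rw [pow_succ, ← mul_assoc, ih, add_mul, mul_assoc, h.h21, mul_add, smul_mul_assoc,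
        mul_smul_comm, ← mul_assoc, ← mul_assoc, h10']
      simp only [mul_assoc, ← pow_succ]
      push_cast
      module
  refine ⟨Set.mem_univ _, fun i e _ => ?_⟩
  have hm : ∀ l m n, l + m + n = e 0 + e 1 + e 2 + 1 →
      X 0 ^ l * X 1 ^ m * X 2 ^ n ∈ monoFilt 𝕜 X B3 (e 0 + e 1 + e 2 + 1) := fun l m n hlmn =>
    mono_mem_monoFilt (e := ![l, m, n]) (Set.mem_univ _) hlmn.le
  fin_cases i <;> simp only [Fin.zero_eta, Fin.mk_one, Fin.reduceFinMk, mono]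
  · rw [← mul_assoc, ← mul_assoc, ← pow_succ']
    exact hm _ _ _ (by omega)
  · rw [← mul_assoc, ← mul_assoc, h10, mul_assoc (X 0 ^ e 0), ← pow_succ']
    exact hm _ _ _ (by omega)
  · have : X 2 * (X 0 ^ e 0 * X 1 ^ e 1 * X 2 ^ e 2) =
        X 0 ^ e 0 * X 1 ^ e 1 * X 2 ^ (e 2 + 1) +
          (e 1 * (p - 2 * q) - e 0 * q : 𝕜) • (X 0 ^ (e 0 + 1) * X 1 ^ e 1 * X 2 ^ e 2) := by
      rw [← mul_assoc, ← mul_assoc, h20, sub_mul, mul_assoc (X 0 ^ e 0), h21, mul_add, sub_mul,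
        add_mul, mul_smul_comm, smul_mul_assoc, smul_mul_assoc, smul_mul_assoc, pow_succ' (X 2),
        pow_succ (X 0)]
      simp only [mul_assoc]
      module
    rw [this]
    exact add_mem (hm _ _ _ (by omega)) (Submodule.smul_mem _ _ (hm _ _ _ (by omega)))

/-- Common to `B1` and `B0`. The sets differ only in whether the exponent of x_2 may be raised,
which is isolated in `hnext`. -/
theorem SatB.isStraight {p : 𝕜} (h : SatB p X) (hE : E ⊆ B1) (h0 : 0 ∈ E)
    (hE' : ∀ e ∈ E, ∀ l m, l < 2 → m < 2 → ![l, m, e 2] ∈ E)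
    (hnext : ∀ e ∈ E, mono X ![e 0, e 1, e 2 + 1] ∈ monoFilt 𝕜 X E (e 0 + e 1 + e 2 + 1)) :
    IsStraight 𝕜 X E := by
  refine ⟨h0, fun i e he => ?_⟩
  have hm : ∀ l m, l < 2 → m < 2 → l + m ≤ e 0 + e 1 + 1 →
      X 0 ^ l * X 1 ^ m * X 2 ^ e 2 ∈ monoFilt 𝕜 X E (e 0 + e 1 + e 2 + 1) :=
    fun l m hl hm hlm => mono_mem_monoFilt (e := ![l, m, e 2]) (hE' e he l m hl hm)
      (show l + m + e 2 ≤ _ by omega)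
  have hn := hnext e he
  rw [mono_vec] at hn
  obtain ⟨he0, he1⟩ := hE he
  rw [mono]
  generalize e 0 = l at *
  generalize e 1 = m at *
  generalize e 2 = n at *
  have r10 := mul_mul_of_eq h.h10
  have r20 := mul_mul_of_eq h.h20
  have r21 := mul_mul_of_eq h.h21
  have r00 := mul_mul_of_eq h.h00
  have r11 := mul_mul_of_eq h.h11
  have m01 := hm 0 1 (by omega) (by omega)
  have m10 := hm 1 0 (by omega) (by omega)
  have m11 := hm 1 1 (by omega) (by omega)
  fin_cases i <;> interval_cases l <;> interval_cases m <;>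
    simp only [Fin.zero_eta, Fin.mk_one, Fin.reduceFinMk, pow_zero, pow_one, one_mul, mul_one,
      pow_succ' (X 2), mul_assoc, r10, r20, r21, r00, r11, zero_mul, mul_zero, neg_mul,
      mul_neg, neg_neg, sub_mul, mul_sub, smul_mul_assoc, mul_smul_comm, smul_zero, sub_zero,
      neg_mem_iff, zero_mem, add_zero, zero_add, Nat.reduceAdd, neg_zero] at hn m01 m10 m11 ⊢
  all_goals first
    | assumption
    | exact m01 (by omega)
    | exact m10 (by omega)
    | exact m11 (by omega)
    | exact sub_mem (neg_mem hn) (Submodule.smul_mem _ _ (m11 (by omega)))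

theorem SatB.isStraight_B1 {p : 𝕜} (h : SatB p X) : IsStraight 𝕜 X B1 :=
  h.isStraight le_rfl ⟨by simp, by simp⟩ (fun _ _ _ _ hl hm => ⟨hl, hm⟩)
    fun e he => mono_mem_monoFilt (e := ![e 0, e 1, e 2 + 1]) he (le_of_eq rfl)

theorem B0_subset_B1 : B0 ⊆ B1 := fun _ he => ⟨he 0, he 1⟩

theorem SatC.isStraight {p k : 𝕜} (h : SatC p k X) : IsStraight 𝕜 X B0 := by
  have vec_mem : ∀ {l m n : ℕ}, l < 2 → m < 2 → n < 2 → ![l, m, n] ∈ B0 := by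
    intro l m n hl hm hn i
    fin_cases i <;> assumption
  refine h.toSatB.isStraight B0_subset_B1 (fun i => by simp)
    (fun e he l m hl hm => vec_mem hl hm (he 2)) fun e he => ?_
  have h0 := he 0
  have h1 := he 1
  have h2 := he 2
  have hm : ∀ l m n, l < 2 → m < 2 → n < 2 → l + m + n ≤ e 0 + e 1 + e 2 + 1 →
      X 0 ^ l * X 1 ^ m * X 2 ^ n ∈ monoFilt 𝕜 X B0 (e 0 + e 1 + e 2 + 1) :=
    fun l m n hl hm hn hlm => mono_mem_monoFilt (e := ![l, m, n]) (vec_mem hl hm hn) hlm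
  rw [mono_vec]
  generalize e 0 = l at *
  generalize e 1 = m at *
  generalize e 2 = n at *
  interval_cases n
  · exact hm l m 1 h0 h1 (by omega) (by omega)
  · have m110 := hm 1 1 0 (by omega) (by omega) (by omega)
    have m101 := hm 1 0 1 (by omega) (by omega) (by omega)
    have m111 := hm 1 1 1 (by omega) (by omega) (by omega)
    have r10 := mul_mul_of_eq h.h10
    have r00 := mul_mul_of_eq h.h00
    -- Every term replacing x_2² contains x_0, so only monomials without x_0 leave a nonzero
    -- remainder.
    rw [show 1 + 1 = 2 from rfl, pow_two, h.h22]
    interval_cases l <;> interval_cases m <;>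
      simp only [pow_zero, pow_one, one_mul, mul_one, mul_assoc, r10, r00, h.h11,
        zero_mul, mul_zero, neg_mul, mul_neg, mul_sub, mul_smul_comm, smul_zero, sub_zero,
        zero_mem, neg_zero, smul_neg, zero_sub, neg_neg] at m110 m101 m111 ⊢
    · exact sub_mem (neg_mem (Submodule.smul_mem _ _ (m110 (by omega))))
        (Submodule.smul_mem _ _ (m101 (by omega)))
    · exact Submodule.smul_mem _ _ (m111 (by omega))

/-- A linearly independent family with the same degrees as the monomials exhibits the monomials as
linearly independent, and has the same span. -/
theorem mono_linearIndependent_of_family {w : E → A} (hw : LinearIndependent 𝕜 w)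
    (hdeg : ∀ e : E, w e ∈ monoFilt 𝕜 X E (e.1 0 + e.1 1 + e.1 2)) :
    (LinearIndependent 𝕜 fun e : E => mono X e.1) ∧
      ∀ n, monoFilt 𝕜 X E n ≤ Submodule.span 𝕜 (Set.range w) := by
  classical
  have hfin : ∀ n, Finite {e : E // e.1 0 + e.1 1 + e.1 2 ≤ n} := by
    intro n
    refine Finite.of_injective (β := Set.Iic (fun _ : Fin 3 => n)) (fun e => ⟨e.1.1, fun i => ?_⟩)
      fun e e' hee => Subtype.ext (Subtype.ext (congrArg Subtype.val hee :))
    have := e.2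
    fin_cases i <;> simp only [Fin.zero_eta, Fin.mk_one, Fin.reduceFinMk] <;> omega
  have hfilt : ∀ n, monoFilt 𝕜 X E n = Submodule.span 𝕜 (Set.range
      fun e : {e : E // e.1 0 + e.1 1 + e.1 2 ≤ n} => mono X e.1.1) := by
    intro n
    rw [monoFilt]
    congr 1
    ext u
    constructor
    · rintro ⟨e, he, rfl⟩; exact ⟨⟨⟨e, he.1⟩, he.2⟩, rfl⟩
    · rintro ⟨e, rfl⟩; exact ⟨e.1.1, ⟨e.1.2, e.2⟩, rfl⟩
  have hfd : ∀ n, FiniteDimensional 𝕜 (monoFilt 𝕜 X E n) := fun n =>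
    Module.Finite.iff_fg.2 (monoFilt_fg n)
  -- The n-th piece is spanned by its monomials and contains equally many independent vectors `w e`.
  -- Its dimension is therefore that number, so the monomials are independent and the `w e` span.
  have key : ∀ n, (LinearIndependent 𝕜
      fun e : {e : E // e.1 0 + e.1 1 + e.1 2 ≤ n} => mono X e.1.1) ∧
      monoFilt 𝕜 X E n ≤ Submodule.span 𝕜 (Set.range w) := by
    intro n
    have := Fintype.ofFinite {e : E // e.1 0 + e.1 1 + e.1 2 ≤ n}
    have hw' : LinearIndependent 𝕜
        fun e : {e : E // e.1 0 + e.1 1 + e.1 2 ≤ n} => w e.1 := hw.comp _ Subtype.val_injective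
    have hle : Submodule.span 𝕜 (Set.range
        fun e : {e : E // e.1 0 + e.1 1 + e.1 2 ≤ n} => w e.1) ≤ monoFilt 𝕜 X E n := by
      refine Submodule.span_le.2 ?_
      rintro _ ⟨e, rfl⟩
      exact monoFilt_monotone e.2 (hdeg e.1)
    have hcard := Submodule.finrank_mono hle
    rw [finrank_span_eq_card hw'] at hcard
    have hcard' : Module.finrank 𝕜 (monoFilt 𝕜 X E n) ≤
        Fintype.card {e : E // e.1 0 + e.1 1 + e.1 2 ≤ n} := by
      rw [hfilt]; exact finrank_range_le_card _
    refine ⟨linearIndependent_iff_card_eq_finrank_span.2 ?_, ?_⟩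
    · rw [Set.finrank, ← hfilt]; exact le_antisymm hcard hcard'
    · rw [← Submodule.eq_of_le_of_finrank_le hle (by rwa [finrank_span_eq_card hw'])]
      exact Submodule.span_mono (Set.range_comp_subset_range _ _)
  refine ⟨?_, fun n => (key n).2⟩
  rw [linearIndependent_iff_finset_linearIndependent]
  intro s
  let n := s.sup fun e => e.1 0 + e.1 1 + e.1 2
  exact (key n).1.comp (fun e : s => ⟨e.1, Finset.le_sup (f := fun e : E => e.1 0 + e.1 1 + e.1 2)
    e.2⟩) fun e e' hee => Subtype.ext (congrArg Subtype.val hee :)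

/-- s has degree two, so trading x_2^{e_2} for s^{⌊e_2/2⌋} x_2^{e_2 mod 2} keeps the degree. -/
theorem IsStraight.quadMono_mem (h : IsStraight 𝕜 X E) (p k : 𝕜) (e : Fin 3 → ℕ) :
    quadMono p k X e ∈ monoFilt 𝕜 X E (e 0 + e 1 + e 2) := by
  have mem : ∀ i, X i ∈ monoFilt 𝕜 X E 1 := fun i => by simpa using h.gen_mul_mem i h.one_mem
  have mul : ∀ i j u v, u ∈ monoFilt 𝕜 X E i → v ∈ monoFilt 𝕜 X E j →
      u * v ∈ monoFilt 𝕜 X E (i + j) := fun i j u v hu hv =>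
    h.mul_le i j (Submodule.mul_mem_mul hu hv)
  have pow : ∀ i u n, u ∈ monoFilt 𝕜 X E i → u ^ n ∈ monoFilt 𝕜 X E (n * i) := by
    intro i u n hu
    induction n with
    | zero => rw [pow_zero, zero_mul]; exact h.one_mem
    | succ n ih => rw [pow_succ, add_mul, one_mul]; exact mul _ _ _ _ ih hu
  have mul2 : ∀ i j, X i * X j ∈ monoFilt 𝕜 X E 2 := fun i j => mul 1 1 _ _ (mem i) (mem j)
  have hq : quad p k X ∈ monoFilt 𝕜 X E 2 := by
    rw [quad]
    exact add_mem (add_mem (mul2 _ _) (Submodule.smul_mem _ _ (mul2 _ _)))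
      (Submodule.smul_mem _ _ (mul2 _ _))
  have h0 := pow 1 _ (e 0) (mem 0)
  have h1 := pow 1 _ (e 1) (mem 1)
  have h2 := pow 1 _ (e 2 % 2) (mem 2)
  have h3 := mul _ _ _ _ (pow 2 _ (e 2 / 2) hq) (mul _ _ _ _ (mul _ _ _ _ h0 h1) h2)
  rwa [show e 2 / 2 * 2 + (e 0 * 1 + e 1 * 1 + e 2 % 2 * 1) = e 0 + e 1 + e 2 by omega] at h3

end MonomialBases

/-! ### The ideal J(V) and the monomial basis in each case. -/

section Presentation

variable {𝕜 A : Type*} [Field 𝕜] [Ring A] [Algebra 𝕜 A] {π : FreeAlgebra 𝕜 (Fin 3) →ₐ[𝕜] A}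

/-- Hopf ideals are killed by all the functionals `derFunctional`; so if these separate the points
of the quotient by a Hopf ideal, that ideal is the largest one. -/
theorem nicholsIdeal_eq_of_triangular {r : Fin 3 → Fin 3 → Fin 3 → Fin 3 → 𝕜}
    {G : Set (FreeAlgebra 𝕜 (Fin 3))} (hker : ∀ x, π x = 0 ↔ x ∈ TwoSidedIdeal.span G)
    (hG : IsHomogeneousHopfIdeal r (TwoSidedIdeal.span G)) {D : Fin 3 → Module.End 𝕜 A}
    {ε : A →ₗ[𝕜] 𝕜} (hD : ∀ i y, D i (π y) = π (skewDer r i y))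
    (hε : ∀ y, ε (π y) = FreeAlgebra.algebraMapInv y) {E : Type*} (l m n : E → ℕ)
    (hinj : Function.Injective fun e => lexKey (l e) (m e) (n e)) {v : E → A}
    (hlt : ∀ e e', lexKey (l e') (m e') (n e') < lexKey (l e) (m e) (n e) →
      derFunctional ε D (l e) (m e) (n e) (v e') = 0)
    (hne : ∀ e, derFunctional ε D (l e) (m e) (n e) (v e) ≠ 0)
    (hspan : Submodule.span 𝕜 (Set.range v) = ⊤) :
    nicholsIdeal r = TwoSidedIdeal.span G := by
  refine le_antisymm (sSup_le fun I hI x hx => (hker x).1 ?_) (le_sSup hG)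
  exact eq_zero_of_triangular_of_span _ hinj v _ hlt hne hspan fun e =>
    counit_pow_skewDer_eq_zero hD hε hI hx (l e) (m e) (n e)

theorem skewDer_quotient_one {r : Fin 3 → Fin 3 → Fin 3 → Fin 3 → 𝕜} {D : Fin 3 → Module.End 𝕜 A}
    (hD : ∀ i y, D i (π y) = π (skewDer r i y)) (i : Fin 3) : D i 1 = 0 := by
  rw [← map_one π, hD, skewDer_one, map_zero]

theorem counit_quotient_one {ε : A →ₗ[𝕜] 𝕜}
    (hε : ∀ y, ε (π y) = FreeAlgebra.algebraMapInv y) : ε 1 = 1 := by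
  rw [← map_one π, hε, map_one]

/-- The quotient by `relA`: defining relations, monomial basis and straightening for `t = 1`. -/
theorem presentation_relA [CharZero 𝕜] {a p q k : 𝕜} (hπ : Function.Surjective π)
    (hker : ∀ x, π x = 0 ↔ x ∈ TwoSidedIdeal.span (relA p q)) :
    nicholsIdeal (c12 1 a (p - 2 * q) p q k) = TwoSidedIdeal.span (relA p q) ∧
    (LinearIndependent 𝕜 fun e : B3 => mono (fun i => π (FreeAlgebra.ι 𝕜 i)) e.1) ∧
    Submodule.span 𝕜 (Set.range fun e : B3 => mono (fun i => π (FreeAlgebra.ι 𝕜 i)) e.1) = ⊤ ∧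
    IsStraight 𝕜 (fun i => π (FreeAlgebra.ι 𝕜 i)) B3 := by
  have hG := isHomogeneousHopfIdeal_relA (a := a) (k := k) hπ hker
  obtain ⟨D, hD⟩ := exists_skewDer_quotient _ hπ hker hG
  obtain ⟨ε, hε⟩ := exists_counit_quotient _ hπ hker hG
  have hstr : IsStraight 𝕜 (fun i => π (FreeAlgebra.ι 𝕜 i)) B3 :=
    ((forall_relA_iff π).1 fun g hg => (hker g).2 (TwoSidedIdeal.subset_span hg)).isStraight
  have hspan := hstr.span_eq_top hπ fun _ => rfl
  have tri := derFunctional_mono_one (derRel_quotient hπ hD) (skewDer_quotient_one hD)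
    (counit_quotient_one hε)
  have hinj : Function.Injective fun e : B3 => lexKey (e.1 0) (e.1 1) (e.1 2) := by
    intro e e' hee
    obtain ⟨h0, h1, h2⟩ := lexKey_inj hee
    ext i
    fin_cases i <;> assumption
  have hlt := fun e e' : B3 => (tri e.1 e'.1).1
  have hne : ∀ e : B3, derFunctional ε D (e.1 0) (e.1 1) (e.1 2)
      (mono (fun i => π (FreeAlgebra.ι 𝕜 i)) e.1) ≠ 0 := by
    intro e
    rw [(tri e.1 e.1).2]
    exact_mod_cast mul_ne_zero (mul_ne_zero (Nat.factorial_ne_zero _) (Nat.factorial_ne_zero _))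
      (Nat.factorial_ne_zero _)
  exact ⟨nicholsIdeal_eq_of_triangular hker hG hD hε _ _ _ hinj hlt hne hspan,
    linearIndependent_of_triangular _ hinj _ _ hlt hne, hspan, hstr⟩

/-- Quotients satisfying `SatB` in which the scalars `chainCoeff` needed do not vanish. -/
theorem presentation_of_SatB {a p q k : 𝕜} {G : Set (FreeAlgebra 𝕜 (Fin 3))}
    {E : Set (Fin 3 → ℕ)} (hE : E ⊆ B1) (hπ : Function.Surjective π)
    (hker : ∀ x, π x = 0 ↔ x ∈ TwoSidedIdeal.span G)
    (hG : IsHomogeneousHopfIdeal (c12 (-1) a (-p) p q k) (TwoSidedIdeal.span G))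
    (hB : SatB p fun i => π (FreeAlgebra.ι 𝕜 i))
    (hstr : IsStraight 𝕜 (fun i => π (FreeAlgebra.ι 𝕜 i)) E)
    (hcoeff : ∀ e ∈ E, ∀ j < 2 * (e 2 / 2) + e 0, chainCoeff (a + p ^ 2) j ≠ 0) :
    nicholsIdeal (c12 (-1) a (-p) p q k) = TwoSidedIdeal.span G ∧
    (LinearIndependent 𝕜 fun e : E => mono (fun i => π (FreeAlgebra.ι 𝕜 i)) e.1) ∧
    Submodule.span 𝕜 (Set.range fun e : E => mono (fun i => π (FreeAlgebra.ι 𝕜 i)) e.1) = ⊤ ∧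
    IsStraight 𝕜 (fun i => π (FreeAlgebra.ι 𝕜 i)) E := by
  obtain ⟨D, hD⟩ := exists_skewDer_quotient _ hπ hker hG
  obtain ⟨ε, hε⟩ := exists_counit_quotient _ hπ hker hG
  have tri := fun {e e' : Fin 3 → ℕ} (he : e ∈ B1) (he' : e' ∈ B1) =>
    derFunctional_quadMono (derRel_quotient hπ hD) hB (skewDer_quotient_one hD)
      (counit_quotient_one hε) he he'
  -- Since e_0 < 2, the number 2⌊e_2/2⌋ + e_0 determines both e_0 and ⌊e_2/2⌋.
  have hinj : Function.Injective fun e : E =>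
      lexKey (2 * (e.1 2 / 2) + e.1 0) (e.1 1) (e.1 2 % 2) := by
    intro e e' hee
    obtain ⟨h0, h1, h2⟩ := lexKey_inj hee
    have he := (hE e.2).1
    have he' := (hE e'.2).1
    ext i
    fin_cases i <;> simp only [Fin.zero_eta, Fin.mk_one, Fin.reduceFinMk] <;> omega
  have hlt := fun e e' : E => (tri (hE e.2) (hE e'.2)).1
  have hne : ∀ e : E, derFunctional ε D (2 * (e.1 2 / 2) + e.1 0) (e.1 1) (e.1 2 % 2)
      (quadMono p k (fun i => π (FreeAlgebra.ι 𝕜 i)) e.1) ≠ 0 := by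
    intro e
    obtain ⟨n, hn⟩ := (tri (hE e.2) (hE e.2)).2
    rw [hn]
    exact mul_ne_zero (pow_ne_zero _ (neg_ne_zero.2 one_ne_zero))
      (Finset.prod_ne_zero_iff.2 fun j hj => hcoeff e.1 e.2 j (Finset.mem_range.1 hj))
  have hli := linearIndependent_of_triangular _ hinj _ _ hlt hne
  have hspan := hstr.span_eq_top hπ fun _ => rfl
  -- The functionals are triangular on the `quadMono` family, while spanning is known for ordered
  -- monomials; the count by degree supplies the missing half for each.
  obtain ⟨hmono, hle⟩ := mono_linearIndependent_of_family hli fun e => hstr.quadMono_mem p k e.1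
  refine ⟨nicholsIdeal_eq_of_triangular hker hG hD hε _ _ _ hinj hlt hne ?_, hmono, hspan, hstr⟩
  refine eq_top_iff.2 fun u _ => ?_
  obtain ⟨n, hn⟩ := exists_mem_monoFilt hspan u
  exact hle n hn

/-- The quotient by `relB`, for `t = -1` and `a ≠ -p²`. -/
theorem presentation_relB [CharZero 𝕜] {a p q k : 𝕜} (ha : a ≠ -p ^ 2)
    (hπ : Function.Surjective π) (hker : ∀ x, π x = 0 ↔ x ∈ TwoSidedIdeal.span (relB p)) :
    nicholsIdeal (c12 (-1) a (-p) p q k) = TwoSidedIdeal.span (relB p) ∧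
    (LinearIndependent 𝕜 fun e : B1 => mono (fun i => π (FreeAlgebra.ι 𝕜 i)) e.1) ∧
    Submodule.span 𝕜 (Set.range fun e : B1 => mono (fun i => π (FreeAlgebra.ι 𝕜 i)) e.1) = ⊤ ∧
    IsStraight 𝕜 (fun i => π (FreeAlgebra.ι 𝕜 i)) B1 := by
  have hB := (forall_relB_iff π).1 fun g hg => (hker g).2 (TwoSidedIdeal.subset_span hg)
  refine presentation_of_SatB le_rfl hπ hker (isHomogeneousHopfIdeal_relB hπ hker) hB
    hB.isStraight_B1 fun e _ j _ => ?_
  rw [chainCoeff]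
  split_ifs
  · exact one_ne_zero
  · refine neg_ne_zero.2 (mul_ne_zero (Nat.cast_ne_zero.2 (Nat.succ_ne_zero _)) fun h => ha ?_)
    exact eq_neg_of_add_eq_zero_left h

/-- The quotient by `relC`, for `t = -1` and `a = -p²`. -/
theorem presentation_relC {p q k : 𝕜}
    (hπ : Function.Surjective π) (hker : ∀ x, π x = 0 ↔ x ∈ TwoSidedIdeal.span (relC p k)) :
    nicholsIdeal (c12 (-1) (-p ^ 2) (-p) p q k) = TwoSidedIdeal.span (relC p k) ∧
    (LinearIndependent 𝕜 fun e : B0 => mono (fun i => π (FreeAlgebra.ι 𝕜 i)) e.1) ∧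
    Submodule.span 𝕜 (Set.range fun e : B0 => mono (fun i => π (FreeAlgebra.ι 𝕜 i)) e.1) = ⊤ ∧
    IsStraight 𝕜 (fun i => π (FreeAlgebra.ι 𝕜 i)) B0 := by
  have hC := (forall_relC_iff π).1 fun g hg => (hker g).2 (TwoSidedIdeal.subset_span hg)
  refine presentation_of_SatB B0_subset_B1 hπ hker (isHomogeneousHopfIdeal_relC hπ hker) hC.toSatB
    hC.isStraight fun e he j hj => ?_
  have h0 := he 0
  have h2 := he 2
  -- With e_0, e_2 < 2 only j = 0 occurs, so the vanishing scalar a + p² is never met.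
  rw [chainCoeff, if_pos (by omega)]
  exact one_ne_zero

end Presentation

/-! ### Counting monomials. -/

section Growth

variable {𝕜 A : Type*} [Field 𝕜] [Ring A] [Algebra 𝕜 A] {X : Fin 3 → A}

theorem IsStraight.gkDim_B3 (h : IsStraight 𝕜 X B3)
    (hspan : Submodule.span 𝕜 (Set.range fun e : B3 => mono X e.1) = ⊤)
    (hli : LinearIndependent 𝕜 fun e : B3 => mono X e.1) : gkDim 𝕜 A = 3 := by
  -- The exponents of degree at most n lie in the cube [0, n]³ and contain the cube [0, n/3]³.
  refine (h.gkDim_eq hspan hli 3 (C := 1) le_rfl (fun n => ?_) (c := 1 / 27) (by norm_num)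
    fun n => ?_).trans (by norm_num)
  · refine ⟨Fintype.piFinset fun _ => Finset.range (n + 1), fun e he => ?_, by simp⟩
    have hn := he.2
    simp only [Finset.mem_coe, Fintype.mem_piFinset, Finset.mem_range]
    intro i
    fin_cases i <;> simp only [Fin.zero_eta, Fin.mk_one, Fin.reduceFinMk] <;> omega
  · refine ⟨Fintype.piFinset fun _ => Finset.range (n / 3 + 1), fun e he => ?_, ?_⟩
    · simp only [Finset.mem_coe, Fintype.mem_piFinset, Finset.mem_range] at he
      have h0 := he 0
      have h1 := he 1
      have h2 := he 2
      exact ⟨Set.mem_univ _, by omega⟩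
    · have hn : (n : ℝ) / 3 ≤ ((n / 3 + 1 : ℕ) : ℝ) := by
        rw [div_le_iff₀ (by norm_num)]
        exact_mod_cast (by omega : n ≤ (n / 3 + 1) * 3)
      calc (1 / 27 : ℝ) * (n : ℝ) ^ 3 = ((n : ℝ) / 3) ^ 3 := by ring
        _ ≤ ((n / 3 + 1 : ℕ) : ℝ) ^ 3 := by gcongr
        _ = _ := by simp

theorem IsStraight.gkDim_B1 (h : IsStraight 𝕜 X B1)
    (hspan : Submodule.span 𝕜 (Set.range fun e : B1 => mono X e.1) = ⊤)
    (hli : LinearIndependent 𝕜 fun e : B1 => mono X e.1) : gkDim 𝕜 A = 1 := by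
  -- Four choices of (e_0, e_1) bound the count from above; the powers of x_2 bound it from below.
  refine (h.gkDim_eq hspan hli 1 (C := 4) (by norm_num) (fun n => ?_) (c := 1) one_pos
    fun n => ?_).trans (by norm_num)
  · refine ⟨Fintype.piFinset ![Finset.range 2, Finset.range 2, Finset.range (n + 1)],
      fun e he => ?_, ?_⟩
    · obtain ⟨⟨h0, h1⟩, hn⟩ := he
      simp only [Finset.mem_coe, Fintype.mem_piFinset]
      intro i
      fin_cases i
      · exact Finset.mem_range.2 h0
      · exact Finset.mem_range.2 h1
      · exact Finset.mem_range.2 (show e 2 < n + 1 by omega)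
    · rw [Fintype.card_piFinset, Fin.prod_univ_three]
      simp only [Matrix.cons_val, Finset.card_range]
      push_cast
      linarith
  · refine ⟨(Finset.range (n + 1)).image fun j => ![0, 0, j], fun e he => ?_, ?_⟩
    · obtain ⟨j, hj, rfl⟩ := Finset.mem_image.1 he
      rw [Finset.mem_range] at hj
      exact ⟨⟨zero_lt_two, zero_lt_two⟩, show 0 + 0 + j ≤ n by omega⟩
    · rw [Finset.card_image_of_injective _ fun i j hij => congrFun hij 2, Finset.card_range]
      push_cast
      linarith

theorem B0_eq_coe_piFinset :
    B0 = (Fintype.piFinset fun _ : Fin 3 => Finset.range 2 : Finset (Fin 3 → ℕ)) := by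
  ext e
  simp [B0]

theorem IsStraight.gkDim_B0 (h : IsStraight 𝕜 X B0)
    (hspan : Submodule.span 𝕜 (Set.range fun e : B0 => mono X e.1) = ⊤)
    (hli : LinearIndependent 𝕜 fun e : B0 => mono X e.1) : gkDim 𝕜 A = 0 := by
  refine (h.gkDim_eq hspan hli 0 (C := 8) (by norm_num) (fun n => ?_) (c := 1) one_pos
    fun n => ?_).trans (by norm_num)
  · refine ⟨Fintype.piFinset fun _ => Finset.range 2, fun e he => ?_, by norm_num⟩
    rw [← B0_eq_coe_piFinset]
    exact he.1
  · refine ⟨{0}, fun e he => ?_, by simp⟩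
    rw [Finset.coe_singleton, Set.mem_singleton_iff] at he
    exact he ▸ ⟨h.zero_mem, Nat.zero_le n⟩

theorem finrank_B0 (hspan : Submodule.span 𝕜 (Set.range fun e : B0 => mono X e.1) = ⊤)
    (hli : LinearIndependent 𝕜 fun e : B0 => mono X e.1) : Module.finrank 𝕜 A = 8 := by
  rw [Module.finrank_eq_nat_card_basis (Module.Basis.mk hli hspan.ge), B0_eq_coe_piFinset,
    Nat.card_coe_set_eq, Set.ncard_coe_finset]
  simp

end Growth

/-! ### The kernel of the quotient map. -/

section Quotient

variable {𝕜 : Type*} [Field 𝕜]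

theorem mkₐ_eq_zero_iff (I : TwoSidedIdeal (FreeAlgebra 𝕜 (Fin 3))) (x : FreeAlgebra 𝕜 (Fin 3)) :
    RingCon.mkₐ 𝕜 I.ringCon x = 0 ↔ x ∈ I := by
  conv_rhs => rw [← I.ker_ringCon_mk']
  exact (TwoSidedIdeal.mem_ker _).symm

end Quotient

end Nichols
end

theorem proposition3p7 {𝕜 : Type*} [Field 𝕜] [IsAlgClosed 𝕜] [CharZero 𝕜]
    (t a b p q k : 𝕜) :
    (t = 1 → b = p - 2 * q →
      Nichols.nicholsIdeal (Nichols.c12 t a b p q k) = TwoSidedIdeal.span (Nichols.relA p q) ∧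
      Nichols.IsMonomialBasis (Nichols.c12 t a b p q k) Nichols.B3 ∧
      Nichols.gkDim 𝕜 (Nichols.NicholsAlgebra (Nichols.c12 t a b p q k)) = 3) ∧
    (t = -1 → b = -p → a ≠ -p ^ 2 →
      Nichols.nicholsIdeal (Nichols.c12 t a b p q k) = TwoSidedIdeal.span (Nichols.relB p) ∧
      Nichols.IsMonomialBasis (Nichols.c12 t a b p q k) Nichols.B1 ∧
      Nichols.gkDim 𝕜 (Nichols.NicholsAlgebra (Nichols.c12 t a b p q k)) = 1) ∧
    (t = -1 → b = -p → a = -p ^ 2 →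
      Nichols.nicholsIdeal (Nichols.c12 t a b p q k) = TwoSidedIdeal.span (Nichols.relC p k) ∧
      Nichols.IsMonomialBasis (Nichols.c12 t a b p q k) Nichols.B0 ∧
      Nichols.gkDim 𝕜 (Nichols.NicholsAlgebra (Nichols.c12 t a b p q k)) = 0 ∧
      Module.finrank 𝕜 (Nichols.NicholsAlgebra (Nichols.c12 t a b p q k)) = 8) := by
  refine ⟨?_, ?_, ?_⟩
  · rintro rfl rfl
    -- The presentation is applied twice: to T(V) modulo the explicit relations, which identifies
    -- J(V), and then to T(V)/J(V) itself. Stating it for any surjection with the right kernel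
    -- avoids transport along the equality of ideals.
    have hJ := (Nichols.presentation_relA (a := a) (k := k) (RingCon.mkₐ_surjective _)
      (Nichols.mkₐ_eq_zero_iff (TwoSidedIdeal.span (Nichols.relA p q)))).1
    obtain ⟨-, hli, hspan, hstr⟩ := Nichols.presentation_relA (a := a) (k := k)
      (RingCon.mkₐ_surjective _) fun x => (Nichols.mkₐ_eq_zero_iff
        (Nichols.nicholsIdeal (Nichols.c12 1 a (p - 2 * q) p q k)) x).trans (by rw [hJ])
    exact ⟨hJ, ⟨hli, hspan⟩, hstr.gkDim_B3 hspan hli⟩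
  · rintro rfl rfl ha
    have hJ := (Nichols.presentation_relB (q := q) (k := k) ha (RingCon.mkₐ_surjective _)
      (Nichols.mkₐ_eq_zero_iff (TwoSidedIdeal.span (Nichols.relB p)))).1
    obtain ⟨-, hli, hspan, hstr⟩ := Nichols.presentation_relB (q := q) (k := k) ha
      (RingCon.mkₐ_surjective _) fun x => (Nichols.mkₐ_eq_zero_iff
        (Nichols.nicholsIdeal (Nichols.c12 (-1) a (-p) p q k)) x).trans (by rw [hJ])
    exact ⟨hJ, ⟨hli, hspan⟩, hstr.gkDim_B1 hspan hli⟩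
  · rintro rfl rfl rfl
    have hJ := (Nichols.presentation_relC (q := q) (RingCon.mkₐ_surjective _)
      (Nichols.mkₐ_eq_zero_iff (TwoSidedIdeal.span (Nichols.relC p k)))).1
    obtain ⟨-, hli, hspan, hstr⟩ := Nichols.presentation_relC (q := q)
      (RingCon.mkₐ_surjective _) fun x => (Nichols.mkₐ_eq_zero_iff
        (Nichols.nicholsIdeal (Nichols.c12 (-1) (-p ^ 2) (-p) p q k)) x).trans (by rw [hJ])
    exact ⟨hJ, ⟨hli, hspan⟩, hstr.gkDim_B0 hspan hli, Nichols.finrank_B0 hspan hli⟩
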